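/- Work over $\mathbb{Z}[q,q^{-1}]$, and put $[n]_q=\frac{q^n-q^{-n}}{q-q^{-1}}$ and $[n]_q^!=[n]_q[n-1]_q\cdots[1]_q$. Let $\mathcal O_q(n)$ be Manin's quantized coordinate algebra: the $\mathbb{Z}[q,q^{-1}]$-algebra on generators $x_{i,j}$ $(1\le i,j\le n)$ with relations $x_{i,j}x_{k,l}=x_{k,l}x_{i,j}$ if $i<k,\ j>l$; $x_{i,j}x_{k,l}=x_{k,l}x_{i,j}-(q-q^{-1})x_{i,l}x_{k,j}$ if $i>k,\ j>l$; $x_{i,j}x_{i,l}=q^{-1}x_{i,l}x_{i,j}$ if $j>l$; $x_{i,j}x_{k,j}=q\,x_{k,j}x_{i,j}$ if $i<k$. Its comultiplication is $\Delta(x_{i,k})=\sum_j x_{i,j}\otimes x_{j,k}$. It has a basis of normally-ordered monomials $x_A=\prod_{j=1}^{n}\bigl(x_{n,j}^{a_{n,j}}\cdots x_{1,j}^{a_{1,j}}\bigr)$ (factors taken in the order $j=1,\dots,n$), indexed by the $n\times n$ matrices $A$ of non-negative integers. Let $Z(A,B,C)$ be the coefficient of $x_A\otimes x_B$ in $\Delta(x_C)$;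 for non-square matrices, first add rows and columns of zeros to make all three $n\times n$ for a common $n$. The $q$-Schur category (with $0$-strings) has as objects all compositions, i.e. finite sequences of non-negative integers. The morphism space $\operatorname{Hom}(\mu,\lambda)$ is the free $\mathbb{Z}[q,q^{-1}]$-module with standard basis $\{\xi_A\}$, where $A$ runs over the matrices of non-negative integers with row sums $\lambda$ and column sums $\mu$. Composition is $\xi_A\circ\xi_B=\sum_C Z(A,B,C)\,\xi_C$. The tensor product $\star$ is concatenation on objects and $\xi_A\star\xi_B=\xi_{\operatorname{diag}(A,B)}$ on morphisms. The merge $(a,b)\to(a+b)$ is $\xi_{[a\ b]}$, the split $(a+b)\to(a,b)$ is $\xi_{\left[\begin{smallmatrix}a\\b\end{smallmatrix}\right]}$, and the positive crossing $(a,b)\to(b,a)$ is $X_{a,b}:=\xi_{\left[\begin{smallmatrix}0&b\\a&0\end{smallmatrix}\right]}$. For $0\le s\le\min(a,b)$, let $D_s:(a,b)\to(a,b)$ be the double coset diagram with cross strands of thickness $s$. That is, the two strings split as $(a,b)\to(a-s,s,s,b-s)$, the two inner strings of thickness $s$ cross by the positive crossing $X_{s,s}$, and the strings then merge as $(a-s,s,s,b-s)\to(a,b)$.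 **Corollary.** For all integers $a,b\ge 0$, $$X_{b,a}\circ X_{a,b}=\sum_{s=0}^{\min(a,b)}q^{-s(s-1)/2-s(a+b-2s)}\,(q^{-1}-q)^s\,[s]_q^!\;D_s ,$$ where $D_s$ is the standard basis element $\xi_{\left[\begin{smallmatrix}a-s&s\\s&b-s\end{smallmatrix}\right]}$ for each $s$. -/

import Mathlib

open scoped TensorProduct

noncomputable section

namespace QSchur

/-! ### The ground ring `ℤ[q, q⁻¹]` -/

/-- The ground ring `ℤ[q, q⁻¹]`. -/
abbrev Zq : Type := LaurentPolynomial ℤ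

/-- The power `q ^ k`, for an integer `k`. -/
abbrev qpow (k : ℤ) : Zq := LaurentPolynomial.T k

/-- The element `q - q⁻¹`. -/
abbrev hq : Zq := qpow 1 - qpow (-1)

/-- The quantum integer `[n]_q = (q ^ n - q ^ (-n)) / (q - q⁻¹)`, written as the Laurent polynomial
`q ^ (n - 1) + q ^ (n - 3) + ⋯ + q ^ (1 - n)`. -/
def qInt (n : ℕ) : Zq := ∑ k ∈ Finset.range n, qpow ((n : ℤ) - 1 - 2 * k)

/-- The defining property of the quantum integer. -/
theorem hq_mul_qInt (n : ℕ) : hq * qInt n = qpow n - qpow (-n) := by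
  have key : ∀ m : ℕ, hq * ∑ k ∈ Finset.range m, qpow ((n : ℤ) - 1 - 2 * k)
      = qpow n - qpow ((n : ℤ) - 2 * m) := by
    intro m
    induction m with
    | zero => simp
    | succ m ih =>
      rw [Finset.sum_range_succ, mul_add, ih, sub_mul, ← LaurentPolynomial.T_add,
        ← LaurentPolynomial.T_add]
      have h1 : (1 : ℤ) + ((n : ℤ) - 1 - 2 * m) = n - 2 * m := by ring
      have h2 : (-1 : ℤ) + ((n : ℤ) - 1 - 2 * m) = n - 2 * ((m + 1 : ℕ) : ℤ) := by
        push_cast; ring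
      rw [h1, h2]; abel
  have h := key n
  rwa [show (n : ℤ) - 2 * n = -n by ring] at h

/-- The quantum factorial `[n]_q! = [n]_q [n-1]_q ⋯ [1]_q`. -/
def qFactorial (n : ℕ) : Zq := ∏ k ∈ Finset.range n, qInt (k + 1)

/-! ### Manin's quantized coordinate algebra of `n × n` matrices -/

/-- The entries of the `n × n` array `x` satisfy the defining relations of Manin's quantized
coordinate algebra. -/
structure IsManin {n : ℕ} {A : Type*} [Ring A] [Algebra Zq A] (x : Fin n → Fin n → A) :
    Prop where
  comm : ∀ i k j l, i < k → l < j → x i j * x k l = x k l * x i j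
  cross : ∀ i k j l, k < i → l < j → x i j * x k l = x k l * x i j - hq • (x i l * x k j)
  row : ∀ i j l, l < j → x i j * x i l = qpow (-1) • (x i l * x i j)
  col : ∀ i k j, i < k → x i j * x k j = qpow 1 • (x k j * x i j)

/-- The defining relations on the free algebra on generators `x_{i,j}`. -/
inductive ManinRel (n : ℕ) :
    FreeAlgebra Zq (Fin n × Fin n) → FreeAlgebra Zq (Fin n × Fin n) → Prop
  | comm (i k j l : Fin n) : i < k → l < j →
      ManinRel n (FreeAlgebra.ι Zq (i, j) * FreeAlgebra.ι Zq (k, l))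
        (FreeAlgebra.ι Zq (k, l) * FreeAlgebra.ι Zq (i, j))
  | cross (i k j l : Fin n) : k < i → l < j →
      ManinRel n (FreeAlgebra.ι Zq (i, j) * FreeAlgebra.ι Zq (k, l))
        (FreeAlgebra.ι Zq (k, l) * FreeAlgebra.ι Zq (i, j)
          - hq • (FreeAlgebra.ι Zq (i, l) * FreeAlgebra.ι Zq (k, j)))
  | row (i j l : Fin n) : l < j →
      ManinRel n (FreeAlgebra.ι Zq (i, j) * FreeAlgebra.ι Zq (i, l))
        (qpow (-1) • (FreeAlgebra.ι Zq (i, l) * FreeAlgebra.ι Zq (i, j)))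
  | col (i k j : Fin n) : i < k →
      ManinRel n (FreeAlgebra.ι Zq (i, j) * FreeAlgebra.ι Zq (k, j))
        (qpow 1 • (FreeAlgebra.ι Zq (k, j) * FreeAlgebra.ι Zq (i, j)))

/-- Manin's quantized coordinate algebra `𝒪_q(n)` over `ℤ[q, q⁻¹]`. -/
def Oq (n : ℕ) : Type := RingQuot (ManinRel n)

instance (n : ℕ) : Ring (Oq n) := inferInstanceAs (Ring (RingQuot (ManinRel n)))

instance (n : ℕ) : Algebra Zq (Oq n) := inferInstanceAs (Algebra Zq (RingQuot (ManinRel n)))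

/-- The quotient map from the free algebra. -/
def Oq.mk (n : ℕ) : FreeAlgebra Zq (Fin n × Fin n) →ₐ[Zq] Oq n :=
  RingQuot.mkAlgHom Zq (ManinRel n)

theorem Oq.mk_rel {n : ℕ} {x y : FreeAlgebra Zq (Fin n × Fin n)} (h : ManinRel n x y) :
    Oq.mk n x = Oq.mk n y :=
  RingQuot.mkAlgHom_rel Zq h

/-- The generator `x_{i,j}` of `𝒪_q(n)`. -/
def gen {n : ℕ} (i j : Fin n) : Oq n :=
  Oq.mk n (FreeAlgebra.ι Zq (i, j))

theorem isManin_gen (n : ℕ) : IsManin (gen (n := n)) where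
  comm i k j l h h' := by
    simpa [gen] using Oq.mk_rel (ManinRel.comm i k j l h h')
  cross i k j l h h' := by
    simpa only [gen, map_mul, map_sub, map_smul] using
      Oq.mk_rel (ManinRel.cross i k j l h h')
  row i j l h := by
    simpa only [gen, map_mul, map_sub, map_smul] using
      Oq.mk_rel (ManinRel.row i j l h)
  col i k j h := by
    simpa only [gen, map_mul, map_sub, map_smul] using
      Oq.mk_rel (ManinRel.col i k j h)

/-- The universal property of `𝒪_q(n)`. -/
def Oq.lift {n : ℕ} {A : Type*} [Ring A] [Algebra Zq A] (x : Fin n → Fin n → A)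
    (hx : IsManin x) : Oq n →ₐ[Zq] A :=
  RingQuot.liftAlgHom Zq (s := ManinRel n)
    ⟨FreeAlgebra.lift Zq fun p => x p.1 p.2, by
      intro a b h
      cases h with
      | comm i k j l h h' => simpa using hx.comm i k j l h h'
      | cross i k j l h h' =>
        simpa only [map_mul, map_sub, map_smul, FreeAlgebra.lift_ι_apply] using
          hx.cross i k j l h h'
      | row i j l h =>
        simpa only [map_mul, map_sub, map_smul, FreeAlgebra.lift_ι_apply] using hx.row i j l h
      | col i k j h =>
        simpa only [map_mul, map_sub, map_smul, FreeAlgebra.lift_ι_apply] using hx.col i k j h⟩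

theorem Oq.lift_gen {n : ℕ} {A : Type*} [Ring A] [Algebra Zq A] (x : Fin n → Fin n → A)
    (hx : IsManin x) (i j : Fin n) : Oq.lift x hx (gen i j) = x i j := by
  exact (RingQuot.liftAlgHom_mkAlgHom_apply Zq _ _ _).trans (by simp)

/-- Two double sums agree if their diagonal terms and the sums of their transposed pairs of terms
agree. -/
theorem sum_sum_congr_pairs {n : ℕ} {M : Type*} [AddCommMonoid M] (F G : Fin n → Fin n → M)
    (hd : ∀ p, F p p = G p p) (ho : ∀ p m, p < m → F p m + F m p = G p m + G m p) :
    ∑ p, ∑ m, F p m = ∑ p, ∑ m, G p m := by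
  have key : ∀ H : Fin n → Fin n → M, ∑ p, ∑ m, H p m
      = ∑ p, H p p + ∑ p, ∑ m, (if p < m then H p m + H m p else 0) := by
    intro H
    have h1 : ∀ p m, H p m = (if p = m then H p p else 0)
        + ((if p < m then H p m else 0) + (if m < p then H p m else 0)) := by
      intro p m
      rcases lt_trichotomy p m with h | h | h
      · simp [h, h.ne, h.not_gt]
      · subst h; simp
      · simp [h, h.ne', h.not_gt]
    have h2 : ∑ p, ∑ m, (if m < p then H p m else 0)
        = ∑ p, ∑ m, (if p < m then H m p else 0) := Finset.sum_comm
    have h3 : ∀ p m, (if p < m then H p m + H m p else 0)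
        = (if p < m then H p m else 0) + (if p < m then H m p else 0) := by
      intro p m; split_ifs <;> simp
    rw [Finset.sum_congr rfl fun p _ => Finset.sum_congr rfl fun m _ => h1 p m]
    simp only [h3, Finset.sum_add_distrib, h2, Finset.sum_ite_eq, Finset.mem_univ, if_true]
  rw [key F, key G]
  congr 1
  · exact Finset.sum_congr rfl fun p _ => hd p
  · refine Finset.sum_congr rfl fun p _ => Finset.sum_congr rfl fun m _ => ?_
    split_ifs with h
    · exact ho p m h
    · rfl

/-- The matrix product, with entries in a tensor product, of two copies of an array satisfying
Manin's relations again satisfies Manin's relations. -/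
theorem IsManin.comul {n : ℕ} {A : Type*} [Ring A] [Algebra Zq A] {x : Fin n → Fin n → A}
    (hx : IsManin x) : IsManin fun i j => ∑ p, x i p ⊗ₜ[Zq] x p j := by
  have hinv : qpow 1 * qpow (-1) = (1 : Zq) := by
    rw [← LaurentPolynomial.T_add]; simp
  have hprod : ∀ i j k l, (∑ p, x i p ⊗ₜ[Zq] x p j) * (∑ p, x k p ⊗ₜ[Zq] x p l)
      = ∑ p, ∑ m, (x i p * x k m) ⊗ₜ[Zq] (x p j * x m l) := by
    intro i j k l
    simp only [Finset.sum_mul_sum, Algebra.TensorProduct.tmul_mul_tmul]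
  constructor
  · intro i k j l hik hlj
    simp only [hprod]
    refine sum_sum_congr_pairs _ _ (fun p => ?_) (fun p m hpm => ?_)
    · rw [hx.col i k p hik, hx.row p j l hlj]
      simp only [← TensorProduct.smul_tmul', TensorProduct.tmul_smul, smul_smul]
      match_scalars
      linear_combination hinv
    · rw [hx.comm p m j l hpm hlj, hx.cross m p j l hpm hlj, hx.comm i k m p hik hpm,
        hx.cross k i m p hik hpm]
      simp only [TensorProduct.sub_tmul, TensorProduct.tmul_sub, ← TensorProduct.smul_tmul',
        TensorProduct.tmul_smul]
      module
  · intro i k j l hki hlj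
    simp only [hprod, Finset.smul_sum, ← Finset.sum_sub_distrib]
    refine sum_sum_congr_pairs _ _ (fun p => ?_) (fun p m hpm => ?_)
    · rw [hx.col k i p hki, hx.row p j l hlj]
      simp only [← TensorProduct.smul_tmul', TensorProduct.tmul_smul]
      match_scalars
      simp only [hq]
      ring
    · rw [hx.cross i k m p hki hpm, hx.cross m p j l hpm hlj, hx.comm k i m p hki hpm,
        hx.comm p m j l hpm hlj]
      simp only [TensorProduct.sub_tmul, TensorProduct.tmul_sub, ← TensorProduct.smul_tmul',
        TensorProduct.tmul_smul]
      module
  · intro i j l hlj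
    simp only [hprod, Finset.smul_sum]
    refine sum_sum_congr_pairs _ _ (fun p => ?_) (fun p m hpm => ?_)
    · rw [hx.row p j l hlj]
      simp only [TensorProduct.tmul_smul]
    · rw [hx.row i m p hpm, hx.cross m p j l hpm hlj, hx.comm p m j l hpm hlj]
      simp only [TensorProduct.tmul_sub, ← TensorProduct.smul_tmul',
        TensorProduct.tmul_smul]
      match_scalars
      · simp only [hq]
        linear_combination -hinv
      · ring
  · intro i k j hik
    simp only [hprod, Finset.smul_sum]
    refine sum_sum_congr_pairs _ _ (fun p => ?_) (fun p m hpm => ?_)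
    · rw [hx.col i k p hik]
      simp only [← TensorProduct.smul_tmul']
    · rw [hx.col p m j hpm, hx.comm i k m p hik hpm, hx.cross k i m p hik hpm]
      simp only [TensorProduct.sub_tmul, ← TensorProduct.smul_tmul',
        TensorProduct.tmul_smul]
      match_scalars
      · ring
      · simp only [hq]
        linear_combination -hinv

/-- The comultiplication `x_{i,j} ↦ ∑_p x_{i,p} ⊗ x_{p,j}` of `𝒪_q(n)`. -/
def comul (n : ℕ) : Oq n →ₐ[Zq] Oq n ⊗[Zq] Oq n :=
  Oq.lift (fun i j => ∑ p, gen i p ⊗ₜ[Zq] gen p j) (isManin_gen n).comul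

/-- The normally-ordered monomial `x_A`: the columns appear from left to right in increasing order,
and the row indices decrease from left to right within each column, so that
`x_A = ∏_{j = 1, …, n} (∏_{i = n, …, 1} x_{i,j} ^ a_{i,j})`. -/
def normalMonomial {n : ℕ} (A : Matrix (Fin n) (Fin n) ℕ) : Oq n :=
  ((List.finRange n).map fun j =>
    ((List.finRange n).reverse.map fun i => gen i j ^ A i j).prod).prod

open Classical in
/-- The standard basis element `ξ_A` of the `q`-Schur algebra, as a linear functional on `𝒪_q(n)`:
the member indexed by `A` of the basis dual to the normally-ordered monomials `x_B`. (As these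
monomials form a basis of `𝒪_q(n)`, there is precisely one such functional.) -/
def dualMonomial {n : ℕ} (A : Matrix (Fin n) (Fin n) ℕ) : Oq n →ₗ[Zq] Zq :=
  if h : ∃ f : Oq n →ₗ[Zq] Zq, ∀ B, f (normalMonomial B) = if B = A then 1 else 0 then h.choose
  else 0

/-- The structure constant `Z(A, B, C) = ⟨ξ_A ⊗ ξ_B, Δ(x_C)⟩` of the `q`-Schur algebra. -/
def structConst {n : ℕ} (A B C : Matrix (Fin n) (Fin n) ℕ) : Zq :=
  LinearMap.mul' Zq Zq
    (TensorProduct.map (dualMonomial A) (dualMonomial B) (comul n (normalMonomial C)))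

/-! ### The `q`-Schur category

Objects are compositions, i.e. lists of natural numbers (zero parts are allowed), with tensor product
given by concatenation. -/

/-- `Mat(lam, mu)`: matrices of natural numbers with row sums `lam` and column sums `mu`. -/
def Mat (lam mu : List ℕ) : Type :=
  {A : Matrix (Fin lam.length) (Fin mu.length) ℕ //
    (∀ i, ∑ j, A i j = lam.get i) ∧ ∀ j, ∑ i, A i j = mu.get j}

instance (lam mu : List ℕ) : Finite (Mat lam mu) := by
  refine Finite.of_injective
    (β := Fin lam.length → Fin mu.length → Fin (lam.sum + 1))
    (fun A i j => ⟨A.1 i j, Nat.lt_succ_of_le ?_⟩) ?_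
  · calc A.1 i j ≤ ∑ j, A.1 i j := Finset.single_le_sum (f := fun j => A.1 i j)
          (fun _ _ => Nat.zero_le _) (Finset.mem_univ j)
      _ = lam.get i := A.2.1 i
      _ ≤ lam.sum := List.le_sum_of_mem (List.get_mem lam i)
  · intro A B h
    apply Subtype.ext
    funext i j
    simpa using congrFun (congrFun h i) j

instance (lam mu : List ℕ) : Fintype (Mat lam mu) := Fintype.ofFinite _

/-- The `n × n` matrix obtained from `A` by appending rows and columns of zeros. -/
def Mat.pad {lam mu : List ℕ} (A : Mat lam mu) (n : ℕ) : Matrix (Fin n) (Fin n) ℕ :=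
  fun i j => if h : (i : ℕ) < lam.length ∧ (j : ℕ) < mu.length then A.1 ⟨i, h.1⟩ ⟨j, h.2⟩ else 0

/-- The morphism space from `mu` to `lam`: the free `ℤ[q, q⁻¹]`-module with basis `Mat(lam, mu)`
(so it is zero if `mu` and `lam` have different sums). -/
abbrev Hom (mu lam : List ℕ) : Type := Mat lam mu →₀ Zq

/-- The standard basis vector `ξ_A`. -/
def xi {lam mu : List ℕ} (A : Mat lam mu) : Hom mu lam := Finsupp.single A 1

/-- The structure constant `Z(A, B, C)` for matrices that need not be square: enlarge the matrices
by zero rows and columns to a common square format. -/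
def Z {lam mu nu : List ℕ} (A : Mat lam mu) (B : Mat mu nu) (C : Mat lam nu) : Zq :=
  let n := max lam.length (max mu.length nu.length)
  structConst (A.pad n) (B.pad n) (C.pad n)

/-- Vertical composition `f ∘ g`, the bilinear extension of `ξ_A ∘ ξ_B = ∑_C Z(A, B, C) ξ_C`. -/
def comp {lam mu nu : List ℕ} (f : Hom mu lam) (g : Hom nu mu) : Hom nu lam :=
  f.sum fun A x => g.sum fun B y => (x * y) • ∑ C : Mat lam nu, Z A B C • xi C

/-- Identification of the rows of a block matrix. -/
def blockEquiv (l l' : List ℕ) : Fin l.length ⊕ Fin l'.length ≃ Fin (l ++ l').length :=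
  finSumFinEquiv.trans (finCongr List.length_append.symm)

/-- The block diagonal matrix `diag(A, B)`. -/
def Mat.diag {lam mu sig rho : List ℕ} (A : Mat lam mu) (B : Mat sig rho) :
    Mat (lam ++ sig) (mu ++ rho) :=
  ⟨Matrix.reindex (blockEquiv lam sig) (blockEquiv mu rho) (Matrix.fromBlocks A.1 0 0 B.1), by
    constructor
    · intro i
      obtain ⟨i, rfl⟩ := (blockEquiv lam sig).surjective i
      rw [← Equiv.sum_comp (blockEquiv mu rho)]
      rcases i with i | i
      · simp [A.2.1, blockEquiv]
      · simp [B.2.1, blockEquiv]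
    · intro j
      obtain ⟨j, rfl⟩ := (blockEquiv mu rho).surjective j
      rw [← Equiv.sum_comp (blockEquiv lam sig)]
      rcases j with j | j
      · simp [A.2.2, blockEquiv]
      · simp [B.2.2, blockEquiv]⟩

/-- Horizontal composition `f ⋆ g`, the bilinear extension of `ξ_A ⋆ ξ_B = ξ_{diag(A, B)}`. -/
def star {lam mu sig rho : List ℕ} (f : Hom mu lam) (g : Hom rho sig) :
    Hom (mu ++ rho) (lam ++ sig) :=
  f.sum fun A x => g.sum fun B y => (x * y) • xi (A.diag B)

/-- The identity endomorphism `1_lam = ξ_{diag(lam_1, …, lam_ℓ)}`. -/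
def idHom (lam : List ℕ) : Hom lam lam :=
  xi ⟨Matrix.diagonal lam.get, by simp [Matrix.diagonal_apply]⟩

/-! ### The generating morphisms -/

/-- The merge `(a, b) → (c)`, where `a + b = c`. -/
def merge (a b c : ℕ) (h : a + b = c) : Hom [a, b] [c] :=
  xi (lam := [c]) (mu := [a, b]) ⟨!![a, b], by
    constructor
    · intro i; fin_cases i; simpa [Fin.sum_univ_succ] using h
    · intro j; fin_cases j <;> simp⟩

/-- The split `(c) → (a, b)`, where `a + b = c`. -/
def split (a b c : ℕ) (h : a + b = c) : Hom [c] [a, b] :=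
  xi (lam := [a, b]) (mu := [c]) ⟨!![a; b], by
    constructor
    · intro i; fin_cases i <;> simp
    · intro j; fin_cases j; simpa [Fin.sum_univ_succ] using h⟩

/-- The positive crossing `(a, b) → (b, a)`. -/
def crossing (a b : ℕ) : Hom [a, b] [b, a] :=
  xi (lam := [b, a]) (mu := [a, b]) ⟨!![0, b; a, 0], by
    constructor
    · intro i; fin_cases i <;> simp [Fin.sum_univ_succ]
    · intro j; fin_cases j <;> simp [Fin.sum_univ_succ]⟩

/-- The matrix with rows `(a - s, s)` and `(s, b - s)`. -/
def crossMat (a b s : ℕ) (h : s ≤ min a b) : Mat [a, b] [a, b] :=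
  ⟨!![a - s, s; s, b - s], by
    have ha : s ≤ a := h.trans (min_le_left a b)
    have hb : s ≤ b := h.trans (min_le_right a b)
    constructor
    · intro i; fin_cases i <;> simp [Fin.sum_univ_succ] <;> omega
    · intro j; fin_cases j <;> simp [Fin.sum_univ_succ] <;> omega⟩

/-- The double coset diagram from `(a, b)` to `(a, b)` with two cross strands of thickness `s`, read
from bottom to top: both strings split, `(a, b) → (a - s, s, s, b - s)`, then the two inner strings
of thickness `s` cross positively, and then the strings merge, `(a - s, s, s, b - s) → (a, b)`. -/
def crossDiagram (a b s : ℕ) (h : s ≤ min a b) : Hom [a, b] [a, b] :=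
  have ha : a - s + s = a := Nat.sub_add_cancel (h.trans (min_le_left a b))
  have hb : s + (b - s) = b := Nat.add_sub_cancel' (h.trans (min_le_right a b))
  comp (lam := [a, b]) (mu := [a - s, s, s, b - s]) (nu := [a, b])
    (star (merge (a - s) s a ha) (merge s (b - s) b hb))
    (comp (lam := [a - s, s, s, b - s]) (mu := [a - s, s, s, b - s]) (nu := [a, b])
      (star (idHom [a - s]) (star (crossing s s) (idHom [b - s])))
      (star (split (a - s) s a ha) (split s (b - s) b hb)))

end QSchur

end

open scoped TensorProduct

noncomputable section

namespace QSchur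


/-! ### Arrays satisfying Manin's relations, indexed by natural numbers -/

/-! The coefficient of `ξ_C` in a product `ξ_A ∘ ξ_B` is the value of `ξ_A ⊗ ξ_B` on `Δ(x_C)`. For
the two crossings, `C` has row and column sums `(a, b)`, so it is determined by its off-diagonal
entry `s` (`bijective_crossMat`). With indices starting at 0, `c = a - s` and `d = b - s`, one has
`Δ(x_C) = Δ(x₁₀)^s Δ(x₀₀)^c Δ(x₁₁)^d Δ(x₀₁)^s`. The functional `ξ_B` vanishes on the right ideal of
`x₀₀` and on the left ideal of `x₁₁`, so a single term of each `Δ(x_{ij})` survives. What remains is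
`ξ_A(x₁₁^s x₀₁^c x₁₀^d x₀₀^s)` times the value 1 of `ξ_B` on its own monomial. Moving `x₁₁^s` to the
right costs `q^{-s(c+d)}`. Since `ξ_A` vanishes on the left ideal of `x₁₁`, and `x₁₁^s x₀₀^s` is
`q^{-s(s-1)/2} (q⁻¹ - q)^s [s]! x₁₀^s x₀₁^s` modulo that ideal, the coefficient follows
(`apply_gen_pow_straighten`, `structConst_crossing`).

The same method in `𝒪_q(4)` identifies the double coset diagram with a standard basis vector:
composing the inner crossing with the splits, and then the merges with the result, meets only
structure constants 0 and 1 (`structConst_crossing_split`, `structConst_merge`).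

All of this needs the functionals `ξ_A` to exist, as their definition otherwise falls back to 0. A
Fock representation in which `x_A` sends the vacuum to a power of `q` times a basis vector indexed
by `A` provides them (`exists_dual_normalMonomial`). Spanning by the monomials
(`span_normalMonomial`) then reduces vanishing on one-sided ideals to a check on monomials. -/

/-- Manin's relations within one row. -/
def IsManinRow {A : Type*} [Ring A] [Algebra Zq A] (u : ℕ → A) : Prop :=
  ∀ j l, l < j → u j * u l = qpow (-1) • (u l * u j)

/-- Manin's relations between two rows, the first of which has the smaller index. -/
structure IsManinRows {A : Type*} [Ring A] [Algebra Zq A] (u v : ℕ → A) : Prop where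
  comm : ∀ j l, l < j → u j * v l = v l * u j
  cross : ∀ j l, l < j → v j * u l = u l * v j - hq • (v l * u j)
  col : ∀ j, u j * v j = qpow 1 • (v j * u j)

/-- Manin's relations for an infinite array of elements of an algebra. -/
structure IsManinArray {A : Type*} [Ring A] [Algebra Zq A] (y : ℕ → ℕ → A) : Prop where
  row : ∀ i, IsManinRow (y i)
  rows : ∀ i k, i < k → IsManinRows (y i) (y k)

/-- Arrays are indexed by all of `ℕ` because the blocks used below sit at positions `k + l`, which
may exceed `n`; only the top left corner is needed in the end. -/
theorem IsManinArray.isManin {A : Type*} [Ring A] [Algebra Zq A] {y : ℕ → ℕ → A}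
    (hy : IsManinArray y) (n : ℕ) : IsManin fun i j : Fin n => y i j where
  comm i k j l h h' := (hy.rows i k h).comm j l h'
  cross i k j l h h' := (hy.rows k i h).cross j l h'
  row i j l h := hy.row i j l h
  col i k j h := (hy.rows i k h).col j

theorem isManinArray_one (A : Type*) [Ring A] [Algebra Zq A] :
    IsManinArray fun i j => if i = j then (1 : A) else 0 where
  row i j l h := by
    have : ¬ (i = l ∧ i = j) := by omega
    dsimp only
    split_ifs <;> simp_all
  rows i k h := by
    constructor
    · intro j l h'
      split_ifs <;> simp
    · intro j l h'
      have : ¬ (k = l ∧ i = j) := by omega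
      split_ifs <;> simp_all
    · intro j
      have : ¬ (i = j ∧ k = j) := by omega
      split_ifs <;> simp_all

/-- Manin's relations for the `2 × 2` array with rows `(a, b)` and `(c, d)`. -/
structure IsManinBlock {A : Type*} [Ring A] [Algebra Zq A] (a b c d : A) : Prop where
  ba : b * a = qpow (-1) • (a * b)
  dc : d * c = qpow (-1) • (c * d)
  ac : a * c = qpow 1 • (c * a)
  bd : b * d = qpow 1 • (d * b)
  bc : b * c = c * b
  da : d * a = a * d - hq • (c * b)

/-- Left multiplication of an array by the identity matrix in which the `2 × 2` block at the rows and
columns `p, p + 1` is replaced by the block with rows `(a, b)` and `(c, d)`. -/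
def blockMul {A M : Type*} [Ring A] [AddCommGroup M] [Module A M] (p : ℕ) (a b c d : A)
    (v : ℕ → M) : ℕ → M :=
  fun i => if i = p then a • v p + b • v (p + 1) else
    if i = p + 1 then c • v p + d • v (p + 1) else v i

section blockMul

variable {A M : Type*} [Ring A] [AddCommGroup M] [Module A M] (p : ℕ) (a b c d : A) (v : ℕ → M)

theorem blockMul_self : blockMul p a b c d v p = a • v p + b • v (p + 1) := by simp [blockMul]

theorem blockMul_succ : blockMul p a b c d v (p + 1) = c • v p + d • v (p + 1) := by
  simp [blockMul]

theorem blockMul_of_ne {i : ℕ} (h : i ≠ p) (h' : i ≠ p + 1) : blockMul p a b c d v i = v i := by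
  simp [blockMul, h, h']

end blockMul

/-! ### Multiplying an array by an elementary block with commuting entries. -/

theorem mul_add_mul_mul_add_mul {A : Type*} [Ring A] {a b c d u u' v v' : A}
    (h1 : Commute c u) (h2 : Commute c u') (h3 : Commute d u) (h4 : Commute d u') :
    (a * u + b * u') * (c * v + d * v')
      = a * c * (u * v) + a * d * (u * v') + b * c * (u' * v) + b * d * (u' * v') := by
  have e : ∀ {x y z w : A}, Commute z y → x * y * (z * w) = x * z * (y * w) := by
    intro x y z w h
    rw [mul_assoc, ← mul_assoc y, ← h.eq]; simp only [mul_assoc]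
  rw [add_mul, mul_add, mul_add, e h1, e h2, e h3, e h4]; abel

section rows

variable {A : Type*} [Ring A] [Algebra Zq A]

theorem IsManinRows.linComb_right {u v v' : ℕ → A} (h : IsManinRows u v) (h' : IsManinRows u v')
    {c d : A} (hc : ∀ j, Commute c (u j)) (hd : ∀ j, Commute d (u j)) :
    IsManinRows u fun j => c * v j + d * v' j := by
  have e : ∀ {x : A} (_ : ∀ j, Commute x (u j)) (w : A) j, u j * (x * w) = x * (u j * w) :=
    fun hx w j => by rw [← mul_assoc, ← (hx j).eq, mul_assoc]
  constructor
  · intro j l hl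
    simp only [mul_add, add_mul, e hc, e hd, mul_assoc, h.comm j l hl, h'.comm j l hl]
  · intro j l hl
    simp only [mul_add, add_mul, e hc, e hd, mul_assoc, h.cross j l hl, h'.cross j l hl,
      mul_sub, mul_smul_comm]
    module
  · intro j
    simp only [mul_add, add_mul, e hc, e hd, mul_assoc, h.col j, h'.col j, mul_smul_comm,
      smul_add]

theorem IsManinRows.linComb_left {u u' v : ℕ → A} (h : IsManinRows u v) (h' : IsManinRows u' v)
    {a b : A} (ha : ∀ j, Commute a (v j)) (hb : ∀ j, Commute b (v j)) :
    IsManinRows (fun j => a * u j + b * u' j) v := by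
  have e : ∀ {x : A} (_ : ∀ j, Commute x (v j)) (w : A) j, v j * (x * w) = x * (v j * w) :=
    fun hx w j => by rw [← mul_assoc, ← (hx j).eq, mul_assoc]
  constructor
  · intro j l hl
    simp only [mul_add, add_mul, e ha, e hb, mul_assoc, h.comm j l hl, h'.comm j l hl]
  · intro j l hl
    simp only [mul_add, add_mul, e ha, e hb, mul_assoc, h.cross j l hl, h'.cross j l hl,
      mul_sub, mul_smul_comm]
    module
  · intro j
    simp only [mul_add, add_mul, e ha, e hb, mul_assoc, h.col j, h'.col j, mul_smul_comm,
      smul_add]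

theorem qpow_one_mul_qpow_neg_one : qpow 1 * qpow (-1) = (1 : Zq) := by
  rw [← LaurentPolynomial.T_add]; simp

/-- The mixed terms match because `1 - q⁻¹(q - q⁻¹) = q⁻²`: the correction term of `cross` is what
turns `ab` into a multiple of `ba`. -/
theorem IsManinRows.isManinRow_linComb {u v : ℕ → A} (h : IsManinRows u v) (hu : IsManinRow u)
    (hv : IsManinRow v) {a b : A} (hba : b * a = qpow (-1) • (a * b))
    (hau : ∀ j, Commute a (u j)) (hav : ∀ j, Commute a (v j)) (hbu : ∀ j, Commute b (u j))
    (hbv : ∀ j, Commute b (v j)) : IsManinRow fun j => a * u j + b * v j := by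
  intro j l hl
  dsimp only
  rw [mul_add_mul_mul_add_mul (hau j) (hav j) (hbu j) (hbv j),
    mul_add_mul_mul_add_mul (hau l) (hav l) (hbu l) (hbv l), hu j l hl, hv j l hl, hba,
    h.cross j l hl, h.comm j l hl]
  simp only [mul_sub, mul_smul_comm, smul_mul_assoc]
  match_scalars <;> try simp only [hq]
  all_goals first | ring1 | linear_combination -qpow_one_mul_qpow_neg_one

/-- The computation is that of `IsManin.comul`, with two arrays whose entries commute inside one
algebra in place of a tensor product. -/
theorem IsManinRows.linComb {u v : ℕ → A} (h : IsManinRows u v) (hu : IsManinRow u)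
    (hv : IsManinRow v) {a b c d : A} (hb : IsManinBlock a b c d)
    (hau : ∀ j, Commute a (u j)) (hav : ∀ j, Commute a (v j)) (hbu : ∀ j, Commute b (u j))
    (hbv : ∀ j, Commute b (v j)) (hcu : ∀ j, Commute c (u j)) (hcv : ∀ j, Commute c (v j))
    (hdu : ∀ j, Commute d (u j)) (hdv : ∀ j, Commute d (v j)) :
    IsManinRows (fun j => a * u j + b * v j) fun j => c * u j + d * v j := by
  constructor
  · intro j l hl
    rw [mul_add_mul_mul_add_mul (hcu j) (hcv j) (hdu j) (hdv j),
      mul_add_mul_mul_add_mul (hau l) (hav l) (hbu l) (hbv l), hu j l hl, hv j l hl,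
      hb.ac, hb.bd, hb.bc, hb.da, h.cross j l hl, h.comm j l hl]
    simp only [mul_sub, sub_mul, mul_smul_comm, smul_mul_assoc]
    match_scalars
    all_goals first | ring1 | linear_combination qpow_one_mul_qpow_neg_one
  · intro j l hl
    rw [mul_add_mul_mul_add_mul (hau j) (hav j) (hbu j) (hbv j),
      mul_add_mul_mul_add_mul (hcu l) (hcv l) (hdu l) (hdv l),
      mul_add_mul_mul_add_mul (hau l) (hav l) (hbu l) (hbv l), hu j l hl, hv j l hl,
      hb.ac, hb.bd, hb.bc, hb.da, h.cross j l hl, h.comm j l hl]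
    simp only [mul_sub, sub_mul, mul_smul_comm, smul_mul_assoc]
    match_scalars <;> simp only [hq]
    all_goals ring1
  · intro j
    rw [mul_add_mul_mul_add_mul (hau j) (hav j) (hbu j) (hbv j),
      mul_add_mul_mul_add_mul (hcu j) (hcv j) (hdu j) (hdv j),
      hb.ac, hb.bd, hb.bc, hb.da, h.col j]
    simp only [sub_mul, mul_smul_comm, smul_mul_assoc]
    match_scalars <;> try simp only [hq]
    all_goals first | ring1 | linear_combination -qpow_one_mul_qpow_neg_one

end rows

/-- Only the rows `p` and `p + 1` change, so a pair of rows contains none, one or both of the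
changed rows; the last case is the only one that uses all the block relations. -/
theorem IsManinArray.blockMul {A : Type*} [Ring A] [Algebra Zq A] {y : ℕ → ℕ → A}
    (hy : IsManinArray y) {a b c d : A} (hb : IsManinBlock a b c d)
    (ha' : ∀ i j, Commute a (y i j)) (hb' : ∀ i j, Commute b (y i j))
    (hc' : ∀ i j, Commute c (y i j)) (hd' : ∀ i j, Commute d (y i j)) (p : ℕ) :
    IsManinArray fun i j => QSchur.blockMul p a b c d (fun k => y k j) i := by
  have hp : (fun j => QSchur.blockMul p a b c d (fun k => y k j) p)
      = fun j => a * y p j + b * y (p + 1) j := by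
    funext j; simp [blockMul_self]
  have hp1 : (fun j => QSchur.blockMul p a b c d (fun k => y k j) (p + 1))
      = fun j => c * y p j + d * y (p + 1) j := by
    funext j; simp [blockMul_succ]
  have ho : ∀ i, i ≠ p → i ≠ p + 1 →
      (fun j => QSchur.blockMul p a b c d (fun k => y k j) i) = y i := fun i h h' => by
    funext j; exact blockMul_of_ne _ _ _ _ _ _ h h'
  have hr := hy.rows p (p + 1) (by omega)
  constructor
  · intro i
    rcases eq_or_ne i p with rfl | h
    · rw [hp]
      exact hr.isManinRow_linComb (hy.row _) (hy.row _) hb.ba (ha' _) (ha' _) (hb' _) (hb' _)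
    rcases eq_or_ne i (p + 1) with rfl | h1
    · rw [hp1]
      exact hr.isManinRow_linComb (hy.row _) (hy.row _) hb.dc (hc' _) (hc' _) (hd' _) (hd' _)
    rw [ho i h h1]
    exact hy.row i
  · intro i k hik
    rcases eq_or_ne i p with rfl | h
    · rcases eq_or_ne k (i + 1) with rfl | h1
      · rw [hp, hp1]
        exact hr.linComb (hy.row _) (hy.row _) hb (ha' _) (ha' _) (hb' _) (hb' _) (hc' _) (hc' _)
          (hd' _) (hd' _)
      · rw [hp, ho k (by omega) (by omega)]
        exact (hy.rows _ _ hik).linComb_left (hy.rows _ _ (by omega)) (ha' _) (hb' _)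
    rcases eq_or_ne i (p + 1) with rfl | h1
    · rw [hp1, ho k (by omega) (by omega)]
      exact (hy.rows _ _ (by omega)).linComb_left (hy.rows _ _ (by omega)) (hc' _) (hd' _)
    rw [ho i h h1]
    rcases eq_or_ne k p with rfl | h'
    · rw [hp]
      exact (hy.rows _ _ hik).linComb_right (hy.rows _ _ (by omega)) (ha' _) (hb' _)
    rcases eq_or_ne k (p + 1) with rfl | h1'
    · rw [hp1]
      exact (hy.rows _ _ (by omega)).linComb_right (hy.rows _ _ (by omega)) (hc' _) (hd' _)
    rw [ho k h' h1']
    exact hy.rows i k hik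


/-! ### A Fock space representation of `𝒪_q(n)` -/

/-- The Fock space: the free module on the arrays of natural numbers. -/
abbrev Fock : Type := (ℕ × ℕ → ℕ) →₀ Zq

/-- The basis vectors of the Fock space. -/
abbrev fockVec (B : ℕ × ℕ → ℕ) : Fock := Finsupp.single B 1

theorem fock_ext {f g : Module.End Zq Fock} (h : ∀ B, f (fockVec B) = g (fockVec B)) : f = g :=
  Finsupp.lhom_ext fun B x => by
    rw [← mul_one x, ← smul_eq_mul, ← Finsupp.smul_single, map_smul, map_smul, h]

/-- The operator that replaces the entry `m` of an array at `p` by `t m` and multiplies by `c m`. -/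
def slotOp (p : ℕ × ℕ) (c : ℕ → Zq) (t : ℕ → ℕ) : Module.End Zq Fock :=
  Finsupp.linearCombination Zq fun B => c (B p) • fockVec (Function.update B p (t (B p)))

theorem slotOp_fockVec (p : ℕ × ℕ) (c : ℕ → Zq) (t : ℕ → ℕ) (B : ℕ × ℕ → ℕ) :
    slotOp p c t (fockVec B) = c (B p) • fockVec (Function.update B p (t (B p))) := by
  simp [slotOp]

theorem commute_slotOp {p p' : ℕ × ℕ} (h : p ≠ p') (c c' : ℕ → Zq) (t t' : ℕ → ℕ) :
    Commute (slotOp p c t) (slotOp p' c' t') := by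
  refine fock_ext fun B => ?_
  simp only [Module.End.mul_apply, slotOp_fockVec, map_smul, Function.update_of_ne h,
    Function.update_of_ne h.symm, smul_smul, mul_comm (c' _), Function.update_comm h]

theorem slotOp_mul_slotOp (p : ℕ × ℕ) (c c' : ℕ → Zq) (t t' : ℕ → ℕ) :
    slotOp p c t * slotOp p c' t' = slotOp p (fun m => c (t' m) * c' m) (fun m => t (t' m)) := by
  refine fock_ext fun B => ?_
  simp only [Module.End.mul_apply, slotOp_fockVec, map_smul, Function.update_self, smul_smul,
    Function.update_idem, mul_comm]

/-- The creation operator. -/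
def raiseOp (p : ℕ × ℕ) : Module.End Zq Fock := slotOp p (fun _ => 1) (· + 1)

/-- The diagonal operator. -/
def diagOp (p : ℕ × ℕ) : Module.End Zq Fock := slotOp p (fun m => qpow (-m)) id

/-- The annihilation operator. -/
def lowerOp (p : ℕ × ℕ) : Module.End Zq Fock :=
  slotOp p (fun m => qpow (1 - 2 * m) - qpow 1) (· - 1)

theorem slotOp_congr {p : ℕ × ℕ} {c c' : ℕ → Zq} {t t' : ℕ → ℕ} (hc : ∀ m, c m = c' m)
    (ht : ∀ m, c m ≠ 0 → t m = t' m) : slotOp p c t = slotOp p c' t' := by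
  refine fock_ext fun B => ?_
  rw [slotOp_fockVec, slotOp_fockVec, ← hc]
  by_cases h : c (B p) = 0
  · simp [h]
  · rw [ht _ h]

theorem smul_slotOp (r : Zq) (p : ℕ × ℕ) (c : ℕ → Zq) (t : ℕ → ℕ) :
    r • slotOp p c t = slotOp p (fun m => r * c m) t := by
  refine fock_ext fun B => ?_
  rw [LinearMap.smul_apply, slotOp_fockVec, slotOp_fockVec, smul_smul]

/-- This is a `q`-oscillator. The coefficients `q^{1-2m} - q` of the annihilation operator solve the
recursion imposed by `da` with initial value 0 at `m = 0`. -/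
theorem isManinBlock_ops (p : ℕ × ℕ) :
    IsManinBlock (raiseOp p) (diagOp p) (diagOp p) (lowerOp p) where
  ba := by
    simp only [raiseOp, diagOp, slotOp_mul_slotOp, smul_slotOp]
    refine slotOp_congr (fun m => ?_) fun m _ => rfl
    simp only [← LaurentPolynomial.T_add, mul_one, one_mul]
    congr 1; push_cast; ring
  dc := by
    simp only [lowerOp, diagOp, slotOp_mul_slotOp, smul_slotOp]
    refine slotOp_congr (fun m => ?_) fun m _ => rfl
    rcases m with _ | m
    · simp
    simp only [id, Nat.add_sub_cancel, ← mul_assoc, ← LaurentPolynomial.T_add]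
    rw [mul_comm]; congr 2; push_cast; ring
  ac := by
    simp only [raiseOp, diagOp, slotOp_mul_slotOp, smul_slotOp]
    refine slotOp_congr (fun m => ?_) fun m _ => rfl
    simp only [← LaurentPolynomial.T_add, mul_one, one_mul]
    congr 1; push_cast; ring
  bd := by
    simp only [lowerOp, diagOp, slotOp_mul_slotOp, smul_slotOp]
    refine slotOp_congr (fun m => ?_) fun m _ => rfl
    rcases m with _ | m
    · simp
    simp only [id, Nat.add_sub_cancel, mul_sub, sub_mul, ← LaurentPolynomial.T_add]
    congr 2 <;> push_cast <;> ring
  bc := rfl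
  da := by
    refine fock_ext fun B => ?_
    simp only [LinearMap.sub_apply, LinearMap.smul_apply, Module.End.mul_apply, lowerOp,
      raiseOp, diagOp, slotOp_fockVec, map_smul, Function.update_self, smul_smul,
      Function.update_idem, id, Function.update_eq_self, one_mul, mul_one, Nat.add_sub_cancel]
    -- When `B p = 0`, lowering and then raising does not restore the array, as subtraction is
    -- truncated; but the coefficient is then 0.
    have h : ((qpow (1 - 2 * (B p : ℤ)) - qpow 1) •
        fockVec (Function.update B p (B p - 1 + 1)) : Fock)
        = (qpow (1 - 2 * (B p : ℤ)) - qpow 1) • fockVec B := by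
      rcases Nat.eq_zero_or_pos (B p) with h | h
      · simp [h]
      · rw [Nat.sub_add_cancel h, Function.update_eq_self]
    rw [h, ← sub_smul]
    congr 1
    simp only [hq, sub_mul, ← LaurentPolynomial.T_add]
    push_cast
    ring_nf

/-- The `ℕ × ℕ` array of operators obtained by multiplying elementary blocks, one for each slot of a
list. -/
def fockArray (L : List (ℕ × ℕ)) : ℕ → ℕ → Module.End Zq Fock :=
  L.foldr (fun p y i j => blockMul (p.1 + p.2) (raiseOp p) (diagOp p) (diagOp p) (lowerOp p)
    (fun k => y k j) i) fun i j => if i = j then 1 else 0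

/-- The action of the elementary blocks on a sequence of vectors. -/
def fockFold (L : List (ℕ × ℕ)) (v : ℕ → Fock) : ℕ → Fock :=
  L.foldr (fun p w => blockMul (p.1 + p.2) (raiseOp p) (diagOp p) (diagOp p) (lowerOp p) w) v

theorem blockMul_smul {A M : Type*} [Ring A] [AddCommGroup M] [Module A M] (p : ℕ) (a b c d : A)
    (y : ℕ → A) (v : M) (i : ℕ) :
    blockMul p a b c d y i • v = blockMul p a b c d (fun k => y k • v) i := by
  unfold blockMul
  split_ifs <;> simp [add_smul, mul_smul]

/-- Applying a column of a matrix product to a vector is an iterated matrix-vector product, so the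
action of a generator can be followed block by block without multiplying operators. -/
theorem fockArray_apply (L : List (ℕ × ℕ)) (i j : ℕ) (v : Fock) :
    fockArray L i j v = fockFold L (fun k => if k = j then v else 0) i := by
  induction L generalizing i with
  | nil => simp only [fockArray, fockFold, List.foldr_nil]; split_ifs <;> simp
  | cons p L ih =>
    change blockMul _ _ _ _ _ (fun k => fockArray L k j) i • v = blockMul _ _ _ _ _ (fockFold L _) i
    rw [blockMul_smul]
    congr 1
    funext k
    exact ih k

theorem fockFold_append (L L' : List (ℕ × ℕ)) (v : ℕ → Fock) :
    fockFold (L ++ L') v = fockFold L (fockFold L' v) := by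
  simp [fockFold]

theorem Commute.blockMul {A : Type*} [Ring A] {x a b c d : A} {v : ℕ → A} {p : ℕ}
    (ha : Commute x a) (hb : Commute x b) (hc : Commute x c) (hd : Commute x d)
    (hv : ∀ i, Commute x (v i)) (i : ℕ) : Commute x (QSchur.blockMul p a b c d v i) := by
  unfold QSchur.blockMul
  split_ifs
  · exact (ha.mul_right (hv _)).add_right (hb.mul_right (hv _))
  · exact (hc.mul_right (hv _)).add_right (hd.mul_right (hv _))
  · exact hv i

theorem commute_slotOp_fockArray {L : List (ℕ × ℕ)} {p : ℕ × ℕ} (hp : p ∉ L) (c : ℕ → Zq)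
    (t : ℕ → ℕ) (i j : ℕ) : Commute (slotOp p c t) (fockArray L i j) := by
  induction L generalizing i with
  | nil =>
    simp only [fockArray, List.foldr_nil]
    split_ifs
    · exact Commute.one_right _
    · exact Commute.zero_right _
  | cons p' L ih =>
    rw [List.mem_cons, not_or] at hp
    exact Commute.blockMul (v := fun k => fockArray L k j)
      (commute_slotOp hp.1 _ _ _ _) (commute_slotOp hp.1 _ _ _ _)
      (commute_slotOp hp.1 _ _ _ _) (commute_slotOp hp.1 _ _ _ _) (fun k => ih hp.2 k) i

/-- Distinct slots are needed so that the operators of one block commute with those of all the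
others. -/
theorem isManinArray_fockArray {L : List (ℕ × ℕ)} (hL : L.Nodup) :
    IsManinArray (fockArray L) := by
  induction L with
  | nil => exact isManinArray_one _
  | cons p L ih =>
    rw [List.nodup_cons] at hL
    exact (ih hL.2).blockMul (isManinBlock_ops p) (commute_slotOp_fockArray hL.1 _ _)
      (commute_slotOp_fockArray hL.1 _ _) (commute_slotOp_fockArray hL.1 _ _)
      (commute_slotOp_fockArray hL.1 _ _) _

/-! ### The action of a generator on the Fock space, column by column. -/

/-- The slots `(k - 1, j), …, (0, j)`. -/
def colSlots (k j : ℕ) : List (ℕ × ℕ) := (List.range k).reverse.map fun i => (i, j)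

theorem colSlots_succ (k j : ℕ) : colSlots (k + 1) j = (k, j) :: colSlots k j := by
  simp [colSlots, List.range_succ]

/-- The slots in the columns belonging to a list, in the order of the normally-ordered monomials. -/
def slots (n : ℕ) (cols : List ℕ) : List (ℕ × ℕ) := cols.flatMap (colSlots n)

theorem nodup_slots (n : ℕ) {cols : List ℕ} (h : cols.Nodup) : (slots n cols).Nodup := by
  rw [slots, List.nodup_flatMap]
  refine ⟨fun j _ => ?_, ?_⟩
  · exact (List.nodup_reverse.2 List.nodup_range).map fun _ _ h => (Prod.ext_iff.1 h).1
  · refine List.Pairwise.imp (fun hne => ?_) h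
    simp only [Function.onFun, List.disjoint_left, colSlots, List.mem_map]
    rintro _ ⟨_, _, rfl⟩ ⟨_, _, h'⟩
    exact hne (Prod.ext_iff.1 h').2.symm

/-- The columns to the right of the column `j` do not affect the sequence concentrated at `j`. -/
theorem fockFold_right {L : List (ℕ × ℕ)} {j : ℕ} (h : ∀ p ∈ L, j < p.2) (v : Fock) :
    fockFold L (fun k => if k = j then v else 0) = fun k => if k = j then v else 0 := by
  induction L with
  | nil => rfl
  | cons p L ih =>
    change blockMul _ _ _ _ _ (fockFold L _) = _
    rw [ih fun p' hp' => h p' (List.mem_cons_of_mem _ hp')]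
    have hj := h p List.mem_cons_self
    funext k
    unfold blockMul
    have h1 : p.1 + p.2 ≠ j := by omega
    have h2 : p.1 + p.2 + 1 ≠ j := by omega
    split_ifs <;> simp_all

/-- The columns to the left of the column `j` shift a sequence of vectors on which they act
trivially. -/
theorem fockFold_left (n j : ℕ) (v w : ℕ → Fock) (hv : ∀ i < n, v (j + i) = w i)
    (hv0 : ∀ i < j, v i = 0) (hK : ∀ l < j, ∀ k < n, ∀ i < n, diagOp (k, l) (w i) = w i)
    (hD : ∀ l < j, ∀ k < n, ∀ i < n, lowerOp (k, l) (w i) = 0) :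
    ∀ i < n, fockFold (slots n (List.range j)) v i = w i := by
  induction j generalizing v with
  | zero => intro i hi; simpa [fockFold, slots] using hv i hi
  | succ j ih =>
    rw [List.range_succ, slots, List.flatMap_append, fockFold_append]
    -- Invariant after `k` blocks of column `j`: the first `k` vectors have moved down by one
    -- position, position `j + k` is vacant, and later positions are untouched. Each block moves one
    -- vector into the vacancy, since the diagonal operator fixes it and the annihilation operator
    -- kills it.
    have key : ∀ k ≤ n, (∀ i < k, fockFold (colSlots k j) v (j + i) = w i) ∧
        fockFold (colSlots k j) v (j + k) = 0 ∧
        (∀ i, k < i → fockFold (colSlots k j) v (j + i) = v (j + i)) ∧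
        ∀ i < j, fockFold (colSlots k j) v i = 0 := by
      intro k
      induction k with
      | zero =>
        intro _
        refine ⟨by simp, hv0 _ (by omega), fun i _ => rfl, fun i hi => hv0 i (by omega)⟩
      | succ k ihk =>
        intro hk
        obtain ⟨h1, h2, h3, h4⟩ := ihk (by omega)
        have hw : fockFold (colSlots k j) v (j + (k + 1)) = w k := by
          rw [h3 _ (by omega), ← hv k (by omega)]; congr 1; omega
        rw [colSlots_succ]
        change (∀ i < k + 1, blockMul (k + j) _ _ _ _ (fockFold _ v) (j + i) = _) ∧
          blockMul (k + j) _ _ _ _ (fockFold _ v) _ = _ ∧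
          (∀ i, k + 1 < i → blockMul (k + j) _ _ _ _ (fockFold _ v) (j + i) = _) ∧
          ∀ i < j, blockMul (k + j) _ _ _ _ (fockFold _ v) i = _
        rw [add_comm k j]
        refine ⟨fun i hi => ?_, ?_, fun i hi => ?_, fun i hi => ?_⟩
        · rcases Nat.lt_succ_iff_lt_or_eq.1 hi with hi | rfl
          · rw [blockMul_of_ne _ _ _ _ _ _ (by omega) (by omega), h1 i hi]
          · rw [blockMul_self, h2, add_assoc, hw, smul_zero, zero_add]
            exact hK j (by omega) _ (by omega) _ (by omega)
        · rw [← add_assoc, blockMul_succ, h2, add_assoc, hw, smul_zero, zero_add]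
          exact hD j (by omega) _ (by omega) _ (by omega)
        · rw [blockMul_of_ne _ _ _ _ _ _ (by omega) (by omega), h3 i (by omega)]
        · rw [blockMul_of_ne _ _ _ _ _ _ (by omega) (by omega), h4 i hi]
    obtain ⟨h1, -, -, h4⟩ := key n le_rfl
    refine ih _ ?_ ?_ (fun l hl => hK l (by omega)) (fun l hl => hD l (by omega))
    · simpa using h1
    · simpa using h4

/-- The action of a single column. -/
theorem fockFold_col (j k : ℕ) (B : ℕ × ℕ → ℕ) :
    (∀ i < k, ∃ c : ℤ, fockFold (colSlots k j) (fun m => if m = j then fockVec B else 0) (j + i)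
        = qpow c • fockVec (B + Pi.single (i, j) 1)) ∧
      (∃ c : ℤ, fockFold (colSlots k j) (fun m => if m = j then fockVec B else 0) (j + k)
        = qpow c • fockVec B) ∧
      (∀ i, k < i → fockFold (colSlots k j) (fun m => if m = j then fockVec B else 0) (j + i) = 0) ∧
      ∀ i < j, fockFold (colSlots k j) (fun m => if m = j then fockVec B else 0) i = 0 := by
  -- Position `j + k` carries a multiple of the original vector. The block of slot `(k, j)` leaves
  -- there a copy with one entry created and passes a rescaled copy on to position `j + k + 1`.
  induction k with
  | zero =>
    refine ⟨by simp, ⟨0, by simp [fockFold, colSlots]⟩, fun i hi => ?_, fun i hi => ?_⟩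
    · simp [fockFold, colSlots, hi.ne']
    · simp [fockFold, colSlots, hi.ne]
  | succ k ih =>
    obtain ⟨h1, ⟨c, h2⟩, h3, h4⟩ := ih
    rw [colSlots_succ]
    set v : ℕ → Fock := fun m => if m = j then fockVec B else 0
    change (∀ i < k + 1, ∃ c : ℤ, blockMul (k + j) _ _ _ _ (fockFold _ v) (j + i) = _) ∧
      (∃ c : ℤ, blockMul (k + j) _ _ _ _ (fockFold _ v) _ = _) ∧
      (∀ i, k + 1 < i → blockMul (k + j) _ _ _ _ (fockFold _ v) (j + i) = _) ∧
      ∀ i < j, blockMul (k + j) _ _ _ _ (fockFold _ v) i = _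
    rw [add_comm k j]
    refine ⟨fun i hi => ?_, ?_, fun i hi => ?_, fun i hi => ?_⟩
    · rcases Nat.lt_succ_iff_lt_or_eq.1 hi with hi | rfl
      · rw [blockMul_of_ne _ _ _ _ _ _ (by omega) (by omega)]
        exact h1 i hi
      · refine ⟨c, ?_⟩
        rw [blockMul_self, h2, add_assoc, h3 _ (by omega), smul_zero, add_zero]
        change raiseOp (i, j) (_ • _) = _
        rw [map_smul, raiseOp, slotOp_fockVec, one_smul]
        congr 2
        funext p
        by_cases hp : p = (i, j)
        · subst hp; simp
        · simp [hp]
    · refine ⟨c + -(B (k, j) : ℤ), ?_⟩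
      rw [← add_assoc, blockMul_succ, h2, add_assoc, h3 _ (by omega), smul_zero, add_zero]
      change diagOp (k, j) (_ • _) = _
      rw [map_smul, diagOp, slotOp_fockVec, smul_smul, id, Function.update_eq_self,
        ← LaurentPolynomial.T_add]
    · rw [blockMul_of_ne _ _ _ _ _ _ (by omega) (by omega), h3 i (by omega)]
    · rw [blockMul_of_ne _ _ _ _ _ _ (by omega) (by omega), h4 i hi]

/-- The generators act on the basis vectors without entries in the columns to the left by creating an
entry. -/
theorem fockArray_fockVec {n i j : ℕ} (hi : i < n) (hj : j < n) (B : ℕ × ℕ → ℕ)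
    (hB : ∀ k l, l < j → B (k, l) = 0) :
    ∃ c : ℤ, fockArray (slots n (List.range n)) i j (fockVec B)
      = qpow c • fockVec (B + Pi.single (i, j) 1) := by
  -- The columns split into those left of `j`, column `j` and those right of `j`. The rightmost act
  -- first and do nothing; column `j` creates the entry, with row `i` at position `j + i`; the `j`
  -- columns on the left shift this back to position `i`.
  obtain ⟨m, rfl⟩ : ∃ m, n = j + (m + 1) := ⟨n - j - 1, by omega⟩
  obtain ⟨h1, -, -, h4⟩ := fockFold_col j (j + (m + 1)) B
  choose! c hc using h1
  refine ⟨c i, ?_⟩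
  rw [fockArray_apply, List.range_add, List.range_succ_eq_map, slots, List.flatMap_append,
    List.map_cons, List.flatMap_cons, fockFold_append, fockFold_append, fockFold_right]
  · refine fockFold_left (j + (m + 1)) j _ (fun i => qpow (c i) • fockVec (B + Pi.single (i, j) 1))
      hc h4 ?_ ?_ i hi
    · intro l hl k _ i _
      have : (B + Pi.single (i, j) 1 : ℕ × ℕ → ℕ) (k, l) = 0 := by simp [hB k l hl, hl.ne]
      rw [map_smul, diagOp, slotOp_fockVec, this, id, ← this, Function.update_eq_self, this,
        Nat.cast_zero, neg_zero, show qpow 0 = 1 from LaurentPolynomial.T_zero, one_smul]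
    · intro l hl k _ i _
      have : (B + Pi.single (i, j) 1 : ℕ × ℕ → ℕ) (k, l) = 0 := by simp [hB k l hl, hl.ne]
      rw [map_smul, lowerOp, slotOp_fockVec, this]
      simp
  · intro p hp
    simp only [colSlots, List.mem_flatMap, List.mem_map] at hp
    obtain ⟨_, ⟨x, ⟨y, _, rfl⟩, rfl⟩, _, _, rfl⟩ := hp
    dsimp only; omega

/-- The representation of `𝒪_q(n)` on the Fock space. -/
def fockRep (n : ℕ) : Oq n →ₐ[Zq] Module.End Zq Fock :=
  Oq.lift _ ((isManinArray_fockArray (nodup_slots n (List.nodup_range (n := n)))).isManin n)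

theorem fockRep_gen {n : ℕ} (i j : Fin n) :
    fockRep n (gen i j) = fockArray (slots n (List.range n)) i j := Oq.lift_gen _ _ i j

theorem fockRep_gen_pow {n : ℕ} (i j : Fin n) (m : ℕ) (B : ℕ × ℕ → ℕ)
    (hB : ∀ k l, l < (j : ℕ) → B (k, l) = 0) :
    ∃ c : ℤ, fockRep n (gen i j ^ m) (fockVec B)
      = qpow c • fockVec (Pi.single ((i : ℕ), (j : ℕ)) m + B) := by
  induction m with
  | zero => exact ⟨0, by simp⟩
  | succ m ih =>
    obtain ⟨c, hc⟩ := ih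
    obtain ⟨c', hc'⟩ := fockArray_fockVec i.2 j.2 (Pi.single ((i : ℕ), (j : ℕ)) m + B)
      (fun k l hl => by simp [hB k l hl, hl.ne])
    refine ⟨c + c', ?_⟩
    rw [pow_succ', map_mul, Module.End.mul_apply, hc, map_smul, fockRep_gen, hc', smul_smul,
      ← LaurentPolynomial.T_add, add_right_comm, ← Pi.single_add]

/-! ### Normally-ordered monomials applied to the vacuum, and the dual functionals. -/

/-- The pairs of indices in the order of the normally-ordered monomials. -/
def normalPairs (n : ℕ) : List (Fin n × Fin n) :=
  (List.finRange n).flatMap fun j => (List.finRange n).reverse.map fun i => (i, j)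

/-- The order of the factors of the normally-ordered monomials. -/
def NormalLT {n : ℕ} (p p' : Fin n × Fin n) : Prop := p.2 < p'.2 ∨ p.2 = p'.2 ∧ p'.1 < p.1

theorem normalMonomial_eq {n : ℕ} (A : Matrix (Fin n) (Fin n) ℕ) :
    normalMonomial A = ((normalPairs n).map fun p => gen p.1 p.2 ^ A p.1 p.2).prod := by
  rw [normalMonomial, normalPairs, List.map_flatMap, List.flatMap, List.prod_flatten, List.map_map]
  simp only [List.map_map, Function.comp_def]

theorem pairwise_normalPairs (n : ℕ) : (normalPairs n).Pairwise NormalLT := by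
  rw [normalPairs, List.pairwise_flatMap]
  refine ⟨fun j _ => ?_, ?_⟩
  · rw [List.pairwise_map, List.pairwise_reverse]
    exact (List.pairwise_lt_finRange n).imp fun h => Or.inr ⟨rfl, h⟩
  · refine (List.pairwise_lt_finRange n).imp fun h => ?_
    simp only [List.mem_map]
    rintro _ ⟨_, _, rfl⟩ _ ⟨_, _, rfl⟩
    exact Or.inl h

theorem mem_normalPairs {n : ℕ} (p : Fin n × Fin n) : p ∈ normalPairs n := by
  simp [normalPairs, List.mem_flatMap, Prod.ext_iff]

theorem nodup_normalPairs (n : ℕ) : (normalPairs n).Nodup :=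
  (pairwise_normalPairs n).imp fun h h' => by
    subst h'; rcases h with h | h
    · exact lt_irrefl _ h
    · exact lt_irrefl _ h.2

/-- The array of natural numbers with the entries of a matrix at the pairs of a list. -/
def contentArray {n : ℕ} (A : Matrix (Fin n) (Fin n) ℕ) (L : List (Fin n × Fin n)) : ℕ × ℕ → ℕ :=
  (L.map fun p => Pi.single ((p.1 : ℕ), (p.2 : ℕ)) (A p.1 p.2)).sum

theorem contentArray_eq_zero {n : ℕ} (A : Matrix (Fin n) (Fin n) ℕ) (L : List (Fin n × Fin n))
    {j : ℕ} (hL : ∀ p ∈ L, j ≤ (p.2 : ℕ)) (k l : ℕ) (hl : l < j) : contentArray A L (k, l) = 0 := by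
  induction L with
  | nil => rfl
  | cons p L ih =>
    have h := hL p List.mem_cons_self
    have h2 := ih fun p' hp' => hL p' (List.mem_cons_of_mem _ hp')
    simp only [contentArray, List.map_cons, List.sum_cons, Pi.add_apply] at h2 ⊢
    rw [h2, Pi.single_eq_of_ne]
    intro h'
    have := (Prod.ext_iff.1 h').2
    dsimp at this; omega

/-- The last factor acts first, so columns are filled from right to left and each factor meets a
vector with no entries to the left of its own column, as `fockRep_gen_pow` requires. -/
theorem fockRep_prod {n : ℕ} (A : Matrix (Fin n) (Fin n) ℕ) (L : List (Fin n × Fin n))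
    (hL : L.Pairwise NormalLT) :
    ∃ c : ℤ, fockRep n (L.map fun p => gen p.1 p.2 ^ A p.1 p.2).prod (fockVec 0)
      = qpow c • fockVec (contentArray A L) := by
  induction L with
  | nil => exact ⟨0, by simp [contentArray]⟩
  | cons p L ih =>
    rw [List.pairwise_cons] at hL
    obtain ⟨c, hc⟩ := ih hL.2
    obtain ⟨c', hc'⟩ := fockRep_gen_pow p.1 p.2 (A p.1 p.2) (contentArray A L)
      (contentArray_eq_zero A L fun p' hp' => by
        rcases hL.1 p' hp' with h | h
        · exact Fin.le_def.1 h.le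
        · exact (congrArg Fin.val h.1).le)
    refine ⟨c + c', ?_⟩
    rw [List.map_cons, List.prod_cons, map_mul, Module.End.mul_apply, hc, map_smul, hc', smul_smul,
      ← LaurentPolynomial.T_add]
    rfl

theorem contentArray_normalPairs {n : ℕ} (A : Matrix (Fin n) (Fin n) ℕ) (i j : Fin n) :
    contentArray A (normalPairs n) (i, j) = A i j := by
  have key : ∀ L : List (Fin n × Fin n), L.Nodup →
      contentArray A L (i, j) = if (i, j) ∈ L then A i j else 0 := by
    intro L hL
    induction L with
    | nil => simp [contentArray]
    | cons p L ih =>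
      rw [List.nodup_cons] at hL
      have h2 := ih hL.2
      simp only [contentArray, List.map_cons, List.sum_cons, Pi.add_apply] at h2 ⊢
      rw [h2]
      by_cases hp : p = (i, j)
      · subst hp; simp [hL.1]
      · rw [Pi.single_eq_of_ne]
        · simp [Ne.symm hp]
        · intro h; apply hp
          exact Prod.ext (Fin.ext (Prod.ext_iff.1 h).1.symm) (Fin.ext (Prod.ext_iff.1 h).2.symm)
  rw [key _ (nodup_normalPairs n), if_pos (mem_normalPairs _)]

open Classical in
/-- The normally-ordered monomials have a dual family of functionals. -/
theorem exists_dual_normalMonomial {n : ℕ} (A : Matrix (Fin n) (Fin n) ℕ) :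
    ∃ f : Oq n →ₗ[Zq] Zq, ∀ B, f (normalMonomial B) = if B = A then 1 else 0 := by
  choose c hc using fun B : Matrix (Fin n) (Fin n) ℕ =>
    fockRep_prod B (normalPairs n) (pairwise_normalPairs n)
  -- The functional reads off the coefficient of the array of `A` in the image of the vacuum; the
  -- scalar cancels the power of `q` produced by `x_A`.
  refine ⟨qpow (-c A) • (Finsupp.lapply (contentArray A (normalPairs n)) ∘ₗ
    LinearMap.applyₗ (fockVec 0) ∘ₗ (fockRep n).toLinearMap), fun B => ?_⟩
  change qpow (-c A) * (fockRep n (normalMonomial B) (fockVec 0)) _ = _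
  rw [normalMonomial_eq, hc, Finsupp.smul_apply, smul_eq_mul, Finsupp.single_apply]
  by_cases h : B = A
  · subst h
    rw [if_pos rfl, if_pos rfl, mul_one, ← LaurentPolynomial.T_add, neg_add_cancel,
      LaurentPolynomial.T_zero]
  · rw [if_neg h, if_neg, mul_zero, mul_zero]
    intro h'
    apply h
    ext i j
    rw [← contentArray_normalPairs B, h', contentArray_normalPairs]

/-- Existence of the dual functional rules out the default value 0 in the definition. -/
theorem dualMonomial_normalMonomial {n : ℕ} (A B : Matrix (Fin n) (Fin n) ℕ) :
    dualMonomial A (normalMonomial B) = if B = A then 1 else 0 := by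
  have h := exists_dual_normalMonomial A
  rw [dualMonomial, dif_pos h]
  convert h.choose_spec B


/-! ### Commutation up to powers of `q` -/

/-- Two elements commute up to a power of `q`. -/
def QCommute {A : Type*} [Ring A] [Algebra Zq A] (x y : A) : Prop :=
  ∃ c : ℤ, x * y = qpow c • (y * x)

theorem qpow_smul_qpow_smul {M : Type*} [AddCommGroup M] [Module Zq M] (c d : ℤ) (x : M) :
    qpow c • qpow d • x = qpow (c + d) • x := by
  rw [smul_smul, ← LaurentPolynomial.T_add]

theorem qpow_zero_smul {M : Type*} [AddCommGroup M] [Module Zq M] (x : M) :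
    qpow 0 • x = x := by
  rw [show qpow 0 = 1 from LaurentPolynomial.T_zero, one_smul]

namespace QCommute

variable {A : Type*} [Ring A] [Algebra Zq A] {x y z : A}

theorem refl (x : A) : QCommute x x := ⟨0, (qpow_zero_smul _).symm⟩

theorem symm (h : QCommute x y) : QCommute y x := by
  obtain ⟨c, h⟩ := h
  exact ⟨-c, by rw [h, qpow_smul_qpow_smul, neg_add_cancel, qpow_zero_smul]⟩

theorem one_right (x : A) : QCommute x 1 := ⟨0, by rw [qpow_zero_smul, mul_one, one_mul]⟩

theorem mul_right (h : QCommute x y) (h' : QCommute x z) : QCommute x (y * z) := by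
  obtain ⟨c, h⟩ := h
  obtain ⟨d, h'⟩ := h'
  refine ⟨c + d, ?_⟩
  rw [← mul_assoc, h, smul_mul_assoc, mul_assoc, h', mul_smul_comm, qpow_smul_qpow_smul, mul_assoc]

theorem pow_right (h : QCommute x y) (m : ℕ) : QCommute x (y ^ m) := by
  induction m with
  | zero => rw [pow_zero]; exact one_right x
  | succ m ih => rw [pow_succ]; exact ih.mul_right h

theorem pow_left (h : QCommute x y) (m : ℕ) : QCommute (x ^ m) y := (h.symm.pow_right m).symm

theorem list_prod_right {L : List A} (h : ∀ y ∈ L, QCommute x y) : QCommute x L.prod := by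
  induction L with
  | nil => exact one_right x
  | cons y L ih =>
    rw [List.prod_cons]
    exact (h y List.mem_cons_self).mul_right (ih fun z hz => h z (List.mem_cons_of_mem _ hz))

end QCommute

/-- Only `cross` has a second term, and it concerns pairs in which one generator lies strictly below
and strictly to the right of the other. -/
theorem qCommute_gen {n : ℕ} {i j k l : Fin n} (h : ¬ (i < k ∧ j < l)) (h' : ¬ (k < i ∧ l < j)) :
    QCommute (gen i j) (gen k l) := by
  have hx := isManin_gen n
  rcases lt_trichotomy i k with hi | rfl | hi
  · rcases lt_trichotomy j l with hj | rfl | hj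
    · exact absurd ⟨hi, hj⟩ h
    · exact ⟨_, hx.col _ _ _ hi⟩
    · exact ⟨0, by rw [qpow_zero_smul]; exact hx.comm _ _ _ _ hi hj⟩
  · rcases lt_trichotomy j l with hj | rfl | hj
    · exact QCommute.symm ⟨_, hx.row _ _ _ hj⟩
    · exact QCommute.refl _
    · exact ⟨_, hx.row _ _ _ hj⟩
  · rcases lt_trichotomy j l with hj | rfl | hj
    · exact QCommute.symm ⟨0, by rw [qpow_zero_smul]; exact hx.comm _ _ _ _ hi hj⟩
    · exact QCommute.symm ⟨_, hx.col _ _ _ hi⟩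
    · exact absurd ⟨hi, hj⟩ h'

/-- The product of powers of generators along a list. -/
def genProd {n : ℕ} (L : List (Fin n × Fin n)) (B : Matrix (Fin n) (Fin n) ℕ) : Oq n :=
  (L.map fun p => gen p.1 p.2 ^ B p.1 p.2).prod

theorem genProd_congr {n : ℕ} {L : List (Fin n × Fin n)} {B B' : Matrix (Fin n) (Fin n) ℕ}
    (h : ∀ p ∈ L, B p.1 p.2 = B' p.1 p.2) : genProd L B = genProd L B' := by
  unfold genProd
  congr 1
  exact List.map_congr_left fun p hp => by rw [h p hp]

theorem genProd_append {n : ℕ} (L L' : List (Fin n × Fin n)) (B : Matrix (Fin n) (Fin n) ℕ) :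
    genProd (L ++ L') B = genProd L B * genProd L' B := by
  simp [genProd]

/-- The matrix `B + m E_{i,j}`. -/
def addSingle {n : ℕ} (B : Matrix (Fin n) (Fin n) ℕ) (i j : Fin n) (m : ℕ) :
    Matrix (Fin n) (Fin n) ℕ := B + Matrix.single i j m

theorem addSingle_self {n : ℕ} (B : Matrix (Fin n) (Fin n) ℕ) (i j : Fin n) (m : ℕ) :
    addSingle B i j m i j = B i j + m := by simp [addSingle]

theorem addSingle_of_ne {n : ℕ} (B : Matrix (Fin n) (Fin n) ℕ) {i j k l : Fin n} (m : ℕ)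
    (h : (k, l) ≠ (i, j)) : addSingle B i j m k l = B k l := by
  have : ¬ (i = k ∧ j = l) := by rintro ⟨rfl, rfl⟩; exact h rfl
  simp [addSingle, this]

theorem addSingle_addSingle {n : ℕ} (B : Matrix (Fin n) (Fin n) ℕ) (i j : Fin n) (m m' : ℕ) :
    addSingle (addSingle B i j m) i j m' = addSingle B i j (m + m') := by
  simp [addSingle, add_assoc, ← Matrix.single_add]

theorem genProd_addSingle_of_notMem {n : ℕ} {L : List (Fin n × Fin n)} {i j : Fin n}
    (h : (i, j) ∉ L) (B : Matrix (Fin n) (Fin n) ℕ) (m : ℕ) :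
    genProd L (addSingle B i j m) = genProd L B :=
  genProd_congr fun _ hp => addSingle_of_ne B m fun h' => h (h' ▸ hp)

theorem not_normalLT_self {n : ℕ} (p : Fin n × Fin n) : ¬ NormalLT p p := by
  rintro (h | h)
  · exact lt_irrefl _ h
  · exact lt_irrefl _ h.2

/-- On its way to its slot, `x_{i,j}` passes only earlier factors. None of these is strictly below
and to the right, and those strictly above and to the left have exponent 0 by hypothesis, so every
exchange costs a power of `q`. -/
theorem gen_mul_genProd {n : ℕ} {L : List (Fin n × Fin n)} (hL : L.Pairwise NormalLT) {i j : Fin n}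
    (hmem : (i, j) ∈ L) (B : Matrix (Fin n) (Fin n) ℕ)
    (hB : ∀ k l, (k, l) ∈ L → k < i → l < j → B k l = 0) :
    ∃ c : ℤ, gen i j * genProd L B = qpow c • genProd L (addSingle B i j 1) := by
  obtain ⟨L₁, L₂, rfl⟩ := List.append_of_mem hmem
  obtain ⟨-, h2, h12⟩ := List.pairwise_append.1 hL
  rw [List.pairwise_cons] at h2
  have hc : QCommute (gen i j) (genProd L₁ B) := by
    refine QCommute.list_prod_right fun y hy => ?_
    obtain ⟨⟨k, l⟩, hp, rfl⟩ := List.mem_map.1 hy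
    have hlt := h12 (k, l) hp (i, j) List.mem_cons_self
    by_cases hkl : k < i ∧ l < j
    · rw [hB k l (List.mem_append_left _ hp) hkl.1 hkl.2, pow_zero]
      exact QCommute.one_right _
    · refine (qCommute_gen ?_ hkl).pow_right _
      rintro ⟨_, h⟩
      rcases hlt with h' | h'
      · exact lt_asymm h h'
      · exact h.ne h'.1.symm
  obtain ⟨c, hc⟩ := hc
  refine ⟨c, ?_⟩
  have e : ∀ B, genProd ((i, j) :: L₂) B = gen i j ^ B i j * genProd L₂ B := fun B => by
    simp [genProd]
  rw [genProd_append, genProd_append, e, e, addSingle_self, genProd_addSingle_of_notMem,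
    genProd_addSingle_of_notMem, ← mul_assoc, hc, smul_mul_assoc, pow_succ']
  · simp only [mul_assoc]
  · exact fun h => not_normalLT_self _ (h2.1 _ h)
  · exact fun h => not_normalLT_self _ (h12 _ h _ List.mem_cons_self)

/-- Mirror image of `gen_mul_genProd`: the obstruction now comes from later factors, strictly below
and to the right. -/
theorem genProd_mul_gen {n : ℕ} {L : List (Fin n × Fin n)} (hL : L.Pairwise NormalLT) {i j : Fin n}
    (hmem : (i, j) ∈ L) (B : Matrix (Fin n) (Fin n) ℕ)
    (hB : ∀ k l, (k, l) ∈ L → i < k → j < l → B k l = 0) :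
    ∃ c : ℤ, genProd L B * gen i j = qpow c • genProd L (addSingle B i j 1) := by
  obtain ⟨L₁, L₂, rfl⟩ := List.append_of_mem hmem
  obtain ⟨-, h2, h12⟩ := List.pairwise_append.1 hL
  rw [List.pairwise_cons] at h2
  have hc : QCommute (gen i j) (genProd L₂ B) := by
    refine QCommute.list_prod_right fun y hy => ?_
    obtain ⟨⟨k, l⟩, hp, rfl⟩ := List.mem_map.1 hy
    have hlt := h2.1 (k, l) hp
    by_cases hkl : i < k ∧ j < l
    · rw [hB k l (List.mem_append_right _ (List.mem_cons_of_mem _ hp)) hkl.1 hkl.2, pow_zero]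
      exact QCommute.one_right _
    · refine (qCommute_gen hkl ?_).pow_right _
      rintro ⟨_, h⟩
      rcases hlt with h' | h'
      · exact lt_asymm h h'
      · exact h.ne h'.1.symm
  obtain ⟨c, hc⟩ := hc.symm
  refine ⟨c, ?_⟩
  have e : ∀ B, genProd ((i, j) :: L₂) B = gen i j ^ B i j * genProd L₂ B := fun B => by
    simp [genProd]
  rw [genProd_append, genProd_append, e, e, addSingle_self, genProd_addSingle_of_notMem,
    genProd_addSingle_of_notMem, mul_assoc, mul_assoc, hc, mul_smul_comm, mul_smul_comm, pow_succ]
  · simp only [mul_assoc]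
  · exact fun h => not_normalLT_self _ (h2.1 _ h)
  · exact fun h => not_normalLT_self _ (h12 _ h _ List.mem_cons_self)

theorem gen_pow_mul_normalMonomial {n : ℕ} {i j : Fin n} (B : Matrix (Fin n) (Fin n) ℕ)
    (hB : ∀ k l, k < i → l < j → B k l = 0) (m : ℕ) :
    ∃ c : ℤ, gen i j ^ m * normalMonomial B = qpow c • normalMonomial (addSingle B i j m) := by
  induction m with
  | zero => exact ⟨0, by simp [addSingle]⟩
  | succ m ih =>
    obtain ⟨c, hc⟩ := ih
    obtain ⟨c', hc'⟩ := gen_mul_genProd (pairwise_normalPairs n) (mem_normalPairs (i, j))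
      (addSingle B i j m) fun k l _ hk hl => by
        rw [addSingle_of_ne _ _ fun h => hk.ne (Prod.ext_iff.1 h).1, hB k l hk hl]
    refine ⟨c + c', ?_⟩
    rw [pow_succ', mul_assoc, hc, mul_smul_comm, normalMonomial_eq, normalMonomial_eq]
    change _ • (_ * genProd _ _) = _ • genProd _ _
    rw [hc', qpow_smul_qpow_smul, addSingle_addSingle]

theorem normalMonomial_mul_gen_pow {n : ℕ} {i j : Fin n} (B : Matrix (Fin n) (Fin n) ℕ)
    (hB : ∀ k l, i < k → j < l → B k l = 0) (m : ℕ) :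
    ∃ c : ℤ, normalMonomial B * gen i j ^ m = qpow c • normalMonomial (addSingle B i j m) := by
  induction m with
  | zero => exact ⟨0, by simp [addSingle]⟩
  | succ m ih =>
    obtain ⟨c, hc⟩ := ih
    obtain ⟨c', hc'⟩ := genProd_mul_gen (pairwise_normalPairs n) (mem_normalPairs (i, j))
      (addSingle B i j m) fun k l _ hk hl => by
        rw [addSingle_of_ne _ _ fun h => hk.ne' (Prod.ext_iff.1 h).1, hB k l hk hl]
    refine ⟨c + c', ?_⟩
    rw [pow_succ, ← mul_assoc, hc, smul_mul_assoc, normalMonomial_eq, normalMonomial_eq]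
    change _ • (genProd _ _ * _) = _ • genProd _ _
    rw [hc', qpow_smul_qpow_smul, addSingle_addSingle]

/-! ### The normally-ordered monomials span -/

/-- The span of the generators in a column. -/
def colSpan {n : ℕ} (j : Fin n) : Submodule Zq (Oq n) :=
  Submodule.span Zq (Set.range fun i => gen i j)

theorem gen_mem_colSpan {n : ℕ} (i j : Fin n) : gen i j ∈ colSpan j :=
  Submodule.subset_span ⟨i, rfl⟩

/-- Each defining relation rewrites a product with column `k` in front as a combination of products
with column `j` in front. -/
theorem colSpan_mul_colSpan_le {n : ℕ} {j k : Fin n} (hjk : j < k) :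
    colSpan k * colSpan j ≤ colSpan j * colSpan k := by
  have hx := isManin_gen n
  conv_lhs => rw [colSpan, colSpan, Submodule.span_mul_span]
  rw [Submodule.span_le]
  rintro _ ⟨_, ⟨i, rfl⟩, _, ⟨i', rfl⟩, rfl⟩
  have hm : ∀ i i', gen i j * gen i' k ∈ colSpan j * colSpan k := fun i i' =>
    Submodule.mul_mem_mul (gen_mem_colSpan _ _) (gen_mem_colSpan _ _)
  change gen i k * gen i' j ∈ _
  rcases lt_trichotomy i i' with h | rfl | h
  · rw [hx.comm _ _ _ _ h hjk]; exact hm _ _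
  · rw [hx.row _ _ _ hjk]; exact Submodule.smul_mem _ _ (hm _ _)
  · rw [hx.cross _ _ _ _ h hjk]
    exact Submodule.sub_mem _ (hm _ _) (Submodule.smul_mem _ _ (hm _ _))

/-- The span of the products of generators in a column. -/
def colAlg {n : ℕ} (j : Fin n) : Submodule Zq (Oq n) := ⨆ d : ℕ, colSpan j ^ d

theorem one_le_colAlg {n : ℕ} (j : Fin n) : 1 ≤ colAlg j :=
  (pow_zero (colSpan j)).symm.le.trans (le_iSup (fun d : ℕ => colSpan j ^ d) 0)

theorem colSpan_mul_colAlg_le {n : ℕ} (j : Fin n) : colSpan j * colAlg j ≤ colAlg j := by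
  rw [colAlg, Submodule.mul_iSup]
  refine iSup_le fun d => ?_
  rw [← pow_succ']
  exact le_iSup (fun d : ℕ => colSpan j ^ d) (d + 1)

theorem colSpan_mul_colAlg_comm {n : ℕ} {j k : Fin n} (hjk : j < k) :
    colSpan k * colAlg j ≤ colAlg j * colSpan k := by
  rw [colAlg, Submodule.mul_iSup, Submodule.iSup_mul]
  refine iSup_mono fun d => ?_
  induction d with
  | zero => simp
  | succ d ih =>
    calc colSpan k * colSpan j ^ (d + 1) = colSpan k * colSpan j ^ d * colSpan j := by
          rw [pow_succ, mul_assoc]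
      _ ≤ colSpan j ^ d * colSpan k * colSpan j := mul_le_mul_left ih _
      _ = colSpan j ^ d * (colSpan k * colSpan j) := mul_assoc _ _ _
      _ ≤ colSpan j ^ d * (colSpan j * colSpan k) :=
          mul_le_mul_right (colSpan_mul_colSpan_le hjk) _
      _ = _ := by rw [pow_succ, mul_assoc]

/-- The pairs of indices in a column, in the order of the normally-ordered monomials. -/
def colPairs {n : ℕ} (j : Fin n) : List (Fin n × Fin n) :=
  (List.finRange n).reverse.map fun i => (i, j)

theorem mem_colPairs {n : ℕ} {j : Fin n} {p : Fin n × Fin n} : p ∈ colPairs j ↔ p.2 = j := by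
  simp only [colPairs, List.mem_map, List.mem_reverse, List.mem_finRange, true_and, Prod.ext_iff]
  exact ⟨fun ⟨_, h⟩ => h.2.symm, fun h => ⟨p.1, rfl, h.symm⟩⟩

theorem pairwise_colPairs {n : ℕ} (j : Fin n) : (colPairs j).Pairwise NormalLT := by
  rw [colPairs, List.pairwise_map, List.pairwise_reverse]
  exact (List.pairwise_lt_finRange n).imp fun h => Or.inr ⟨rfl, h⟩

/-- Generators of one column commute up to powers of `q`, so the vanishing hypothesis of
`gen_mul_genProd` is vacuous here. -/
theorem colAlg_le {n : ℕ} (j : Fin n) :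
    colAlg j ≤ Submodule.span Zq (Set.range (genProd (colPairs j))) := by
  refine iSup_le fun d => ?_
  induction d with
  | zero =>
    rw [pow_zero, Submodule.one_le]
    refine Submodule.subset_span ⟨0, ?_⟩
    simp [genProd]
  | succ d ih =>
    rw [pow_succ']
    refine (mul_le_mul_right ih _).trans ?_
    rw [colSpan, Submodule.span_mul_span, Submodule.span_le]
    rintro _ ⟨_, ⟨i, rfl⟩, _, ⟨B, rfl⟩, rfl⟩
    obtain ⟨c, hc⟩ := gen_mul_genProd (pairwise_colPairs j) (i := i) (mem_colPairs.2 rfl) B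
      fun k l h _ hl => absurd (mem_colPairs.1 h) hl.ne
    change gen i j * genProd _ B ∈ _
    rw [hc]
    exact Submodule.smul_mem _ _ (Submodule.subset_span ⟨_, rfl⟩)

theorem prod_colAlg_le {n : ℕ} (s : List (Fin n)) (hs : s.Nodup) :
    (s.map colAlg).prod ≤ Submodule.span Zq (Set.range (genProd (s.flatMap colPairs))) := by
  induction s with
  | nil =>
    rw [List.map_nil, List.prod_nil, Submodule.one_le]
    exact Submodule.subset_span ⟨0, by simp [genProd]⟩
  | cons j s ih =>
    rw [List.nodup_cons] at hs
    rw [List.map_cons, List.prod_cons]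
    refine (mul_le_mul' (colAlg_le j) (ih hs.2)).trans ?_
    rw [Submodule.span_mul_span, Submodule.span_le]
    rintro _ ⟨_, ⟨B, rfl⟩, _, ⟨B', rfl⟩, rfl⟩
    -- Column `j` is taken from `B` and the others from `B'`; this is consistent as `j` does not
    -- recur in the list.
    refine Submodule.subset_span ⟨Matrix.of fun i l => if l = j then B i l else B' i l, ?_⟩
    rw [List.flatMap_cons, genProd_append]
    change _ = genProd _ B * genProd _ B'
    congr 1
    · exact genProd_congr fun p hp => if_pos (mem_colPairs.1 hp)
    · refine genProd_congr fun p hp => if_neg fun h => hs.1 ?_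
      obtain ⟨l, hl, hp⟩ := List.mem_flatMap.1 hp
      rwa [← h, mem_colPairs.1 hp]

/-- A generator of column `k` is pushed past all smaller columns until it is absorbed by its own. -/
theorem colSpan_mul_prod_colAlg_le {n : ℕ} (s : List (Fin n)) (hs : s.Pairwise (· < ·)) (k : Fin n)
    (hk : k ∈ s) : colSpan k * (s.map colAlg).prod ≤ (s.map colAlg).prod := by
  induction s with
  | nil => simp at hk
  | cons j s ih =>
    rw [List.pairwise_cons] at hs
    rw [List.map_cons, List.prod_cons, ← mul_assoc]
    rcases List.mem_cons.1 hk with rfl | hk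
    · exact mul_le_mul_left (colSpan_mul_colAlg_le k) _
    · refine (mul_le_mul_left (colSpan_mul_colAlg_comm (hs.1 k hk)) _).trans ?_
      rw [mul_assoc]
      exact mul_le_mul_right (ih hs.2 hk) _

theorem adjoin_gen (n : ℕ) :
    Algebra.adjoin Zq (Set.range fun p : Fin n × Fin n => gen p.1 p.2) = ⊤ := by
  have h := congrArg (Subalgebra.map (Oq.mk n)) (FreeAlgebra.adjoin_range_ι Zq (Fin n × Fin n))
  rw [AlgHom.map_adjoin, ← Set.range_comp, Algebra.map_top] at h
  exact h.trans ((AlgHom.range_eq_top _).2 (RingQuot.mkAlgHom_surjective Zq _))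

/-- The normally-ordered monomials span `𝒪_q(n)`. -/
theorem span_normalMonomial (n : ℕ) :
    Submodule.span Zq (Set.range (normalMonomial (n := n))) = ⊤ := by
  set V : Submodule Zq (Oq n) := ((List.finRange n).map colAlg).prod with hV
  have h1 : (1 : Oq n) ∈ V := by
    rw [← Submodule.one_le]
    exact List.one_le_prod_of_one_le (by simpa using one_le_colAlg)
  have hmem : ∀ y : Oq n, ∀ v ∈ V, y * v ∈ V := by
    -- The elements that stabilise `V` under left multiplication form a subalgebra. It contains the
    -- generators, hence is everything, and `1 ∈ V` gives `V = ⊤`.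
    let S : Subalgebra Zq (Oq n) :=
      { carrier := {y | ∀ v ∈ V, y * v ∈ V}
        mul_mem' := fun {a b} ha hb v hv => by
          rw [mul_assoc]; exact ha _ (hb v hv)
        add_mem' := fun {a b} ha hb v hv => by
          rw [add_mul]; exact V.add_mem (ha v hv) (hb v hv)
        algebraMap_mem' := fun r v hv => by
          rw [← Algebra.smul_def]; exact V.smul_mem r hv }
    have hS : S = ⊤ := by
      rw [eq_top_iff, ← adjoin_gen, Algebra.adjoin_le_iff]
      rintro _ ⟨p, rfl⟩ v hv
      exact colSpan_mul_prod_colAlg_le _ (List.pairwise_lt_finRange n) p.2 (List.mem_finRange _)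
        (Submodule.mul_mem_mul (gen_mem_colSpan p.1 p.2) hv)
    intro y
    exact (hS ▸ Algebra.mem_top : y ∈ S)
  rw [eq_top_iff]
  intro y _
  have hy := prod_colAlg_le _ (List.nodup_finRange n) (by simpa using hmem y 1 h1)
  convert hy using 3
  funext B
  exact normalMonomial_eq B

theorem functional_ext {n : ℕ} {M : Type*} [AddCommGroup M] [Module Zq M] {f g : Oq n →ₗ[Zq] M}
    (h : ∀ B, f (normalMonomial B) = g (normalMonomial B)) : f = g :=
  LinearMap.ext_on_range (span_normalMonomial n) h


/-! ### One-sided ideals on which a functional vanishes -/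

section kills

variable {A : Type*} [Ring A] [Algebra Zq A] {f : A →ₗ[Zq] Zq} {x y u v p s : A}

/-- The functional `f` vanishes on the right ideal generated by `u`. -/
def KillsLeft (f : A →ₗ[Zq] Zq) (u : A) : Prop := ∀ w, f (u * w) = 0

/-- The functional `f` vanishes on the left ideal generated by `u`. -/
def KillsRight (f : A →ₗ[Zq] Zq) (u : A) : Prop := ∀ w, f (w * u) = 0

theorem KillsLeft.mul_right (h : KillsLeft f u) (w : A) : KillsLeft f (u * w) := fun w' => by
  rw [mul_assoc]; exact h _

theorem KillsRight.mul_left (h : KillsRight f u) (w : A) : KillsRight f (w * u) := fun w' => by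
  rw [← mul_assoc]; exact h _

/-- Exchanging `x ^ m` and `y` costs a power of `q` and brings `p * y` to the front. -/
theorem KillsLeft.qCommute_pow (h : KillsLeft f (p * y)) (hxy : QCommute x y) (m : ℕ) :
    KillsLeft f (p * x ^ m * y) := fun w => by
  obtain ⟨c, hc⟩ := hxy.pow_left m
  rw [mul_assoc p, hc, mul_smul_comm, smul_mul_assoc, map_smul, ← mul_assoc, mul_assoc (p * y), h,
    smul_zero]

theorem KillsRight.qCommute_pow (h : KillsRight f (y * s)) (hxy : QCommute x y) (m : ℕ) :
    KillsRight f (y * x ^ m * s) := fun w => by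
  obtain ⟨c, hc⟩ := (hxy.pow_left m).symm
  rw [hc, smul_mul_assoc, mul_smul_comm, map_smul, mul_assoc (x ^ m), ← mul_assoc, h, smul_zero]

theorem KillsLeft.qCommute_pow' (h : KillsLeft f y) (hxy : QCommute x y) (m : ℕ) :
    KillsLeft f (x ^ m * y) := by
  have := KillsLeft.qCommute_pow (p := 1) (by rwa [one_mul]) hxy m
  rwa [one_mul] at this

theorem KillsRight.qCommute_pow' (h : KillsRight f y) (hxy : QCommute x y) (m : ℕ) :
    KillsRight f (y * x ^ m) := by
  have := KillsRight.qCommute_pow (s := 1) (by rwa [mul_one]) hxy m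
  rwa [mul_one] at this

/-- In the expansion of `(u + v) ^ n`, every word other than `v ^ n` begins with `v ^ m * u` for
some `m` and is annihilated. The prefix `p` varies in the induction so as to collect the powers of
`v`. -/
theorem KillsLeft.apply_mul_add_pow (h : ∀ m, KillsLeft f (p * v ^ m * u)) (n : ℕ) (w : A) :
    f (p * (u + v) ^ n * w) = f (p * v ^ n * w) := by
  induction n generalizing p with
  | zero => simp
  | succ n ih =>
    have h0 : f (p * u * ((u + v) ^ n * w)) = 0 := by simpa using h 0 ((u + v) ^ n * w)
    have h1 := ih (p := p * v) fun m => by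
      have := h (m + 1)
      rwa [pow_succ', ← mul_assoc] at this
    have e : p * (u + v) ^ (n + 1) * w
        = p * u * ((u + v) ^ n * w) + p * v * (u + v) ^ n * w := by
      rw [pow_succ']; noncomm_ring
    rw [e, map_add, h0, h1, zero_add, pow_succ', ← mul_assoc p]

theorem KillsRight.apply_mul_add_pow (h : ∀ m, KillsRight f (u * v ^ m * s)) (n : ℕ) (w : A) :
    f (w * ((u + v) ^ n * s)) = f (w * (v ^ n * s)) := by
  induction n generalizing s with
  | zero => simp
  | succ n ih =>
    have h0 : f (w * (u + v) ^ n * (u * s)) = 0 := by simpa using h 0 (w * (u + v) ^ n)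
    have h1 := ih (s := v * s) fun m => by
      have := h (m + 1)
      rwa [pow_succ, ← mul_assoc, mul_assoc _ v] at this
    have e : w * ((u + v) ^ (n + 1) * s)
        = w * (u + v) ^ n * (u * s) + w * ((u + v) ^ n * (v * s)) := by
      rw [pow_succ]; noncomm_ring
    rw [e, map_add, h0, h1, zero_add, pow_succ, mul_assoc (v ^ n)]

end kills

/-! ### Exchanging powers of generators -/

section cross

variable {n : ℕ} {i j k l : Fin n}

/-- The straightening relation for powers, with error term in a right ideal. -/
theorem gen_pow_mul_gen_pow_left (hki : k < i) (hlj : l < j) {y : Oq n}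
    (hy : y = gen i l ∨ y = gen k j) (m m' : ℕ) :
    ∃ r, gen i j ^ m * gen k l ^ m' = gen k l ^ m' * gen i j ^ m + y * r := by
  have hcross := (isManin_gen n).cross _ _ _ _ hki hlj
  have hcomm := (isManin_gen n).comm _ _ _ _ hki hlj
  have hij : QCommute (gen i j) y := by
    rcases hy with rfl | rfl <;> apply qCommute_gen <;> rintro ⟨h, h'⟩ <;>
      first | exact lt_irrefl _ h | exact lt_irrefl _ h'
  have hkl : QCommute (gen k l) y := by
    rcases hy with rfl | rfl <;> apply qCommute_gen <;> rintro ⟨h, h'⟩ <;>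
      first | exact lt_irrefl _ h | exact lt_irrefl _ h'
  -- The two factors of the error term commute with each other, so either can stand in front.
  obtain ⟨r₀, hr₀⟩ : ∃ r, gen i j * gen k l = gen k l * gen i j + y * r := by
    rcases hy with rfl | rfl
    · exact ⟨-(hq • gen k j), by rw [hcross, mul_neg, mul_smul_comm, sub_eq_add_neg]⟩
    · exact ⟨-(hq • gen i l), by rw [hcross, mul_neg, mul_smul_comm, hcomm, sub_eq_add_neg]⟩
  have h1 : ∀ m, ∃ r, gen i j ^ m * gen k l = gen k l * gen i j ^ m + y * r := by
    intro m
    induction m with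
    | zero => exact ⟨0, by simp⟩
    | succ m ih =>
      obtain ⟨r, hr⟩ := ih
      obtain ⟨c, hc⟩ := hij
      refine ⟨r₀ * gen i j ^ m + qpow c • (gen i j * r), ?_⟩
      rw [pow_succ', mul_assoc, hr, mul_add, ← mul_assoc, hr₀, ← mul_assoc _ y, hc, add_mul,
        mul_add, mul_smul_comm, smul_mul_assoc]
      simp only [mul_assoc, add_assoc]
  induction m' with
  | zero => exact ⟨0, by simp⟩
  | succ m' ih =>
    obtain ⟨r, hr⟩ := ih
    obtain ⟨r', hr'⟩ := h1 m
    obtain ⟨c, hc⟩ := hkl.pow_left m'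
    refine ⟨qpow c • (gen k l ^ m' * r') + r * gen k l, ?_⟩
    rw [pow_succ, ← mul_assoc, hr, add_mul, mul_assoc, hr', mul_add, ← mul_assoc _ y, hc, mul_add,
      mul_smul_comm, smul_mul_assoc]
    simp only [mul_assoc, add_assoc]

/-- The straightening relation for powers, with error term in a left ideal. -/
theorem gen_pow_mul_gen_pow_right (hki : k < i) (hlj : l < j) {y : Oq n}
    (hy : y = gen i l ∨ y = gen k j) (m m' : ℕ) :
    ∃ r, gen i j ^ m * gen k l ^ m' = gen k l ^ m' * gen i j ^ m + r * y := by
  have hcross := (isManin_gen n).cross _ _ _ _ hki hlj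
  have hcomm := (isManin_gen n).comm _ _ _ _ hki hlj
  have hij : QCommute (gen i j) y := by
    rcases hy with rfl | rfl <;> apply qCommute_gen <;> rintro ⟨h, h'⟩ <;>
      first | exact lt_irrefl _ h | exact lt_irrefl _ h'
  have hkl : QCommute (gen k l) y := by
    rcases hy with rfl | rfl <;> apply qCommute_gen <;> rintro ⟨h, h'⟩ <;>
      first | exact lt_irrefl _ h | exact lt_irrefl _ h'
  obtain ⟨r₀, hr₀⟩ : ∃ r, gen i j * gen k l = gen k l * gen i j + r * y := by
    rcases hy with rfl | rfl
    · exact ⟨-(hq • gen k j), by rw [hcross, neg_mul, smul_mul_assoc, hcomm, sub_eq_add_neg]⟩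
    · exact ⟨-(hq • gen i l), by rw [hcross, neg_mul, smul_mul_assoc, sub_eq_add_neg]⟩
  have h1 : ∀ m', ∃ r, gen i j * gen k l ^ m' = gen k l ^ m' * gen i j + r * y := by
    intro m'
    induction m' with
    | zero => exact ⟨0, by simp⟩
    | succ m' ih =>
      obtain ⟨r, hr⟩ := ih
      obtain ⟨c, hc⟩ := hkl.symm
      refine ⟨gen k l ^ m' * r₀ + qpow c • (r * gen k l), ?_⟩
      rw [pow_succ, ← mul_assoc, hr, add_mul, mul_assoc, hr₀, mul_assoc r, hc, mul_add,
        add_mul, mul_smul_comm, smul_mul_assoc]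
      simp only [mul_assoc, add_assoc]
  induction m with
  | zero => exact ⟨0, by simp⟩
  | succ m ih =>
    obtain ⟨r, hr⟩ := ih
    obtain ⟨r', hr'⟩ := h1 m'
    obtain ⟨c, hc⟩ := (hij.pow_left m).symm
    refine ⟨gen i j * r + qpow c • (r' * gen i j ^ m), ?_⟩
    rw [pow_succ', mul_assoc, hr, mul_add, ← mul_assoc, hr', add_mul, mul_assoc r' y, hc, add_mul,
      mul_smul_comm, smul_mul_assoc]
    simp only [mul_assoc, add_assoc, add_comm]

variable {f : Oq n →ₗ[Zq] Zq} {p s : Oq n}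

/-- Moving `x_{k,l}` in front of `x_{i,j} ^ m` leaves an error in the right ideal of `x_{i,l}`,
which `f` also annihilates after `p`. -/
theorem KillsLeft.cross_pow (hki : k < i) (hlj : l < j) (h : KillsLeft f (p * gen k l))
    (h' : KillsLeft f (p * gen i l)) (m : ℕ) : KillsLeft f (p * gen i j ^ m * gen k l) := by
  intro w
  obtain ⟨r, hr⟩ := gen_pow_mul_gen_pow_left hki hlj (Or.inl rfl) m 1
  rw [pow_one] at hr
  rw [mul_assoc p, hr, mul_add, add_mul, map_add, ← mul_assoc p, mul_assoc _ _ w, h, ← mul_assoc p,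
    mul_assoc _ _ w, h', add_zero]

theorem KillsRight.cross_pow (hki : k < i) (hlj : l < j) (h : KillsRight f (gen i j * s))
    (h' : KillsRight f (gen k j * s)) (m : ℕ) : KillsRight f (gen i j * gen k l ^ m * s) := by
  intro w
  obtain ⟨r, hr⟩ := gen_pow_mul_gen_pow_right hki hlj (Or.inr rfl) 1 m
  rw [pow_one] at hr
  rw [hr, add_mul, mul_add, map_add, mul_assoc _ _ s, ← mul_assoc, h, mul_assoc r, ← mul_assoc, h',
    add_zero]

end cross

/-! ### Vanishing of the dual basis on one-sided ideals -/

section dual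

variable {n : ℕ}

theorem killsLeft_of_normalMonomial {f : Oq n →ₗ[Zq] Zq} {u : Oq n}
    (h : ∀ B, f (u * normalMonomial B) = 0) : KillsLeft f u := fun w =>
  LinearMap.congr_fun (functional_ext (f := f ∘ₗ LinearMap.mulLeft Zq u) (g := 0) h) w

/-- With no generator strictly above and to the left of `(i, j)`, the product `x_{i,j}^m x_B` is a
power of `q` times a monomial whose exponent at `(i, j)` is at least `m`, hence is not `x_A`. -/
theorem killsLeft_dualMonomial {A : Matrix (Fin n) (Fin n) ℕ} {i j : Fin n}
    (hij : ∀ k l, k < i → ¬ l < j) {m : ℕ} (hm : A i j < m) :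
    KillsLeft (dualMonomial A) (gen i j ^ m) := by
  refine killsLeft_of_normalMonomial fun B => ?_
  obtain ⟨c, hc⟩ := gen_pow_mul_normalMonomial (i := i) (j := j) B
    (fun k l hk hl => absurd hl (hij k l hk)) m
  rw [hc, map_smul, dualMonomial_normalMonomial, if_neg, smul_zero]
  rintro rfl
  rw [addSingle_self] at hm
  omega

/-- In `cross`, the pairs `(i, j), (k, l)` lie in the box together exactly when `(i, l), (k, j)` do,
so all three terms survive or vanish at once. -/
theorem isManin_box (n r c : ℕ) :
    IsManin fun i j : Fin n => if (i : ℕ) < r ∧ (j : ℕ) < c then gen i j else (0 : Oq n) where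
  comm i k j l h h' := by
    have := (isManin_gen n).comm i k j l h h'
    split_ifs <;> simp [*]
  cross i k j l h h' := by
    have := (isManin_gen n).cross i k j l h h'
    have h1 : ((i : ℕ) < r ∧ (j : ℕ) < c) ∧ ((k : ℕ) < r ∧ (l : ℕ) < c) ↔
        ((i : ℕ) < r ∧ (l : ℕ) < c) ∧ ((k : ℕ) < r ∧ (j : ℕ) < c) := by tauto
    by_cases h2 : ((i : ℕ) < r ∧ (j : ℕ) < c) ∧ ((k : ℕ) < r ∧ (l : ℕ) < c)
    · rw [if_pos h2.1, if_pos h2.2, if_pos (h1.1 h2).1, if_pos (h1.1 h2).2, this]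
    · have e : ∀ {P Q : Prop} [Decidable P] [Decidable Q] (x y : Oq n), ¬ (P ∧ Q) →
          (if P then x else 0) * (if Q then y else 0) = 0 := by
        intro P Q _ _ x y hPQ
        by_cases hP : P
        · rw [if_neg fun hQ => hPQ ⟨hP, hQ⟩, mul_zero]
        · rw [if_neg hP, zero_mul]
      rw [e _ _ h2, e _ _ (fun h => h2 h.symm), e _ _ (fun h => h2 (h1.2 h)), smul_zero, sub_zero]
  row i j l h := by
    have := (isManin_gen n).row i j l h
    split_ifs <;> simp [*]
  col i k j h := by
    have := (isManin_gen n).col i k j h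
    split_ifs <;> simp [*]

/-- The endomorphism that annihilates the generators outside the first `r` rows and `c` columns. -/
def boxHom (n r c : ℕ) : Oq n →ₐ[Zq] Oq n := Oq.lift _ (isManin_box n r c)

open Classical in
theorem boxHom_normalMonomial (r c : ℕ) (B : Matrix (Fin n) (Fin n) ℕ) :
    boxHom n r c (normalMonomial B)
      = if ∀ i j : Fin n, ¬ ((i : ℕ) < r ∧ (j : ℕ) < c) → B i j = 0 then
          normalMonomial B else 0 := by
  have e : ∀ i j : Fin n, boxHom n r c (gen i j ^ B i j)
      = (if (i : ℕ) < r ∧ (j : ℕ) < c then gen i j else (0 : Oq n)) ^ B i j := fun i j => by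
    rw [map_pow, boxHom, Oq.lift_gen]
  rw [normalMonomial_eq, map_list_prod, List.map_map]
  split_ifs with h
  · congr 1
    refine List.map_congr_left fun p _ => ?_
    rw [Function.comp_apply, e]
    split_ifs with hp
    · rfl
    · rw [h _ _ hp, pow_zero, pow_zero]
  · push Not at h
    obtain ⟨i, j, hij, hB⟩ := h
    refine List.prod_eq_zero (List.mem_map.2 ⟨(i, j), mem_normalPairs _, ?_⟩)
    rw [Function.comp_apply, e, if_neg fun h => (hij h.1).not_gt h.2, zero_pow hB]

theorem dualMonomial_boxHom {r c : ℕ} {A : Matrix (Fin n) (Fin n) ℕ}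
    (hA : ∀ i j : Fin n, ¬ ((i : ℕ) < r ∧ (j : ℕ) < c) → A i j = 0) (y : Oq n) :
    dualMonomial A (boxHom n r c y) = dualMonomial A y := by
  refine LinearMap.congr_fun
    (functional_ext (f := dualMonomial A ∘ₗ (boxHom n r c).toLinearMap) fun B => ?_) y
  change dualMonomial A (boxHom n r c (normalMonomial B)) = _
  rw [boxHom_normalMonomial]
  split_ifs with h
  · rfl
  · rw [map_zero, dualMonomial_normalMonomial, if_neg]
    rintro rfl
    exact h hA

/-- Passing to the box that supports `A` removes every generator outside it. Since `(i, j)` is in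
the last row or column of the box, nothing is left strictly below and to the right, and right
multiplication only raises an exponent. The box serves padded non-square matrices. -/
theorem killsRight_dualMonomial (r c : ℕ) {A : Matrix (Fin n) (Fin n) ℕ}
    (hA : ∀ i j : Fin n, ¬ ((i : ℕ) < r ∧ (j : ℕ) < c) → A i j = 0) {i j : Fin n}
    (hi : (i : ℕ) < r) (hj : (j : ℕ) < c) (hij : r ≤ i + 1 ∨ c ≤ j + 1) {m : ℕ} (hm : A i j < m) :
    KillsRight (dualMonomial A) (gen i j ^ m) := by
  classical
  intro w
  refine LinearMap.congr_fun
    (functional_ext (f := dualMonomial A ∘ₗ LinearMap.mulRight Zq (gen i j ^ m)) (g := 0)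
      fun B => ?_) w
  change dualMonomial A (normalMonomial B * gen i j ^ m) = 0
  rw [← dualMonomial_boxHom hA, map_mul, boxHom_normalMonomial]
  split_ifs with h
  · obtain ⟨d, hd⟩ := normalMonomial_mul_gen_pow (i := i) (j := j) B
      (fun k l hk hl => h k l fun hkl => by
        have := Fin.lt_def.1 hk
        have := Fin.lt_def.1 hl
        omega) m
    rw [map_pow, boxHom, Oq.lift_gen, if_pos ⟨hi, hj⟩, hd, map_smul, dualMonomial_normalMonomial,
      if_neg, smul_zero]
    rintro rfl
    rw [addSingle_self] at hm
    omega
  · rw [zero_mul, map_zero]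

end dual

/-! ### The pairing with a comultiplication -/

section pairing

variable {n : ℕ}

/-- The functional `f ⊗ g`. -/
def pairing (f g : Oq n →ₗ[Zq] Zq) : Oq n ⊗[Zq] Oq n →ₗ[Zq] Zq :=
  LinearMap.mul' Zq Zq ∘ₗ TensorProduct.map f g

variable {f g : Oq n →ₗ[Zq] Zq}

theorem pairing_tmul (x y : Oq n) : pairing f g (x ⊗ₜ y) = f x * g y := by
  simp [pairing]

theorem structConst_eq (A B C : Matrix (Fin n) (Fin n) ℕ) :
    structConst A B C
      = pairing (dualMonomial A) (dualMonomial B) (comul n (normalMonomial C)) := rfl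

theorem killsLeft_pairing {x y : Oq n} (h : KillsLeft f x ∨ KillsLeft g y) :
    KillsLeft (pairing f g) (x ⊗ₜ y) := by
  intro w
  induction w with
  | zero => simp
  | tmul a b =>
    rw [Algebra.TensorProduct.tmul_mul_tmul, pairing_tmul]
    rcases h with h | h
    · rw [h, zero_mul]
    · rw [h, mul_zero]
  | add a b ha hb => rw [mul_add, map_add, ha, hb, add_zero]

theorem killsRight_pairing {x y : Oq n} (h : KillsRight f x ∨ KillsRight g y) :
    KillsRight (pairing f g) (x ⊗ₜ y) := by
  intro w
  induction w with
  | zero => simp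
  | tmul a b =>
    rw [Algebra.TensorProduct.tmul_mul_tmul, pairing_tmul]
    rcases h with h | h
    · rw [h, zero_mul]
    · rw [h, mul_zero]
  | add a b ha hb => rw [add_mul, map_add, ha, hb, add_zero]

theorem comul_gen (i j : Fin n) : comul n (gen i j) = ∑ p, gen i p ⊗ₜ gen p j :=
  Oq.lift_gen _ _ i j

/-- A power of `Δ(x_{i,j})` may be replaced by the power of a single term, if the other terms are
annihilated from the left. -/
theorem pairing_comul_pow_left (k : Fin n) {i j : Fin n} {P Q : Oq n}
    (h : ∀ p, p ≠ k → ∀ m, KillsLeft f (P * gen i k ^ m * gen i p) ∨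
      KillsLeft g (Q * gen k j ^ m * gen p j)) (m : ℕ) (w : Oq n ⊗[Zq] Oq n) :
    pairing f g (P ⊗ₜ Q * comul n (gen i j) ^ m * w)
      = pairing f g ((P * gen i k ^ m) ⊗ₜ (Q * gen k j ^ m) * w) := by
  rw [comul_gen, ← Finset.sum_erase_add _ _ (Finset.mem_univ k),
    KillsLeft.apply_mul_add_pow, Algebra.TensorProduct.tmul_pow,
    Algebra.TensorProduct.tmul_mul_tmul]
  intro m w
  rw [Finset.mul_sum, Finset.sum_mul, map_sum]
  refine Finset.sum_eq_zero fun p hp => ?_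
  rw [Algebra.TensorProduct.tmul_pow, Algebra.TensorProduct.tmul_mul_tmul,
    Algebra.TensorProduct.tmul_mul_tmul]
  exact killsLeft_pairing (h p (Finset.ne_of_mem_erase hp) m) w

/-- A power of `Δ(x_{i,j})` may be replaced by the power of a single term, if the other terms are
annihilated from the right. -/
theorem pairing_comul_pow_right (k : Fin n) {i j : Fin n} {P Q : Oq n}
    (h : ∀ p, p ≠ k → ∀ m, KillsRight f (gen i p * gen i k ^ m * P) ∨
      KillsRight g (gen p j * gen k j ^ m * Q)) (m : ℕ) (w : Oq n ⊗[Zq] Oq n) :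
    pairing f g (w * (comul n (gen i j) ^ m * P ⊗ₜ Q))
      = pairing f g (w * (gen i k ^ m * P) ⊗ₜ (gen k j ^ m * Q)) := by
  rw [comul_gen, ← Finset.sum_erase_add _ _ (Finset.mem_univ k),
    KillsRight.apply_mul_add_pow, Algebra.TensorProduct.tmul_pow,
    Algebra.TensorProduct.tmul_mul_tmul]
  intro m w
  rw [Finset.sum_mul, Finset.sum_mul, Finset.mul_sum, map_sum]
  refine Finset.sum_eq_zero fun p hp => ?_
  rw [Algebra.TensorProduct.tmul_pow, Algebra.TensorProduct.tmul_mul_tmul,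
    Algebra.TensorProduct.tmul_mul_tmul]
  exact killsRight_pairing (h p (Finset.ne_of_mem_erase hp) m) w

end pairing


/-! ### Structure constants -/

theorem normalMonomial_two (A : Matrix (Fin 2) (Fin 2) ℕ) :
    normalMonomial A = gen 1 0 ^ A 1 0 * gen 0 0 ^ A 0 0 * (gen 1 1 ^ A 1 1 * gen 0 1 ^ A 0 1) := by
  simp [normalMonomial, List.finRange_succ]

theorem normalMonomial_four (A : Matrix (Fin 4) (Fin 4) ℕ) :
    normalMonomial A
      = gen 3 0 ^ A 3 0 * (gen 2 0 ^ A 2 0 * (gen 1 0 ^ A 1 0 * gen 0 0 ^ A 0 0)) *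
        (gen 3 1 ^ A 3 1 * (gen 2 1 ^ A 2 1 * (gen 1 1 ^ A 1 1 * gen 0 1 ^ A 0 1)) *
        (gen 3 2 ^ A 3 2 * (gen 2 2 ^ A 2 2 * (gen 1 2 ^ A 1 2 * gen 0 2 ^ A 0 2)) *
        (gen 3 3 ^ A 3 3 * (gen 2 3 ^ A 2 3 * (gen 1 3 ^ A 1 3 * gen 0 3 ^ A 0 3))))) := by
  simp [normalMonomial, List.finRange_succ]

theorem qCommute_gen_row {n : ℕ} (i j l : Fin n) : QCommute (gen i j) (gen i l) :=
  qCommute_gen (fun h => lt_irrefl _ h.1) fun h => lt_irrefl _ h.1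

theorem qCommute_gen_col {n : ℕ} (i k j : Fin n) : QCommute (gen i j) (gen k j) :=
  qCommute_gen (fun h => lt_irrefl _ h.2) fun h => lt_irrefl _ h.2

theorem qpow_add (c d : ℤ) : qpow (c + d) = qpow c * qpow d := LaurentPolynomial.T_add c d

/-- The normalisation `q^{-m} [m+1] = 1 + q⁻² + ⋯ + q^{-2m}` is the form in which quantum integers
come out of straightening. -/
theorem qpow_neg_mul_qInt_succ (m : ℕ) :
    qpow (-m) * qInt (m + 1) = ∑ k ∈ Finset.range (m + 1), qpow (-2 * k) := by
  rw [qInt, Finset.mul_sum]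
  refine Finset.sum_congr rfl fun k _ => ?_
  rw [← LaurentPolynomial.T_add]
  congr 1; push_cast; ring

theorem qpow_neg_mul_qInt_succ_succ (m : ℕ) :
    qpow (-(m + 1 : ℕ)) * qInt (m + 1 + 1) = 1 + qpow (-2) * (qpow (-m) * qInt (m + 1)) := by
  rw [qpow_neg_mul_qInt_succ, qpow_neg_mul_qInt_succ, Finset.sum_range_succ', Finset.mul_sum,
    add_comm]
  refine congrArg₂ _ ?_ (Finset.sum_congr rfl fun k _ => ?_)
  · rw [Nat.cast_zero, mul_zero]
    exact LaurentPolynomial.T_zero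
  · rw [← LaurentPolynomial.T_add]
    congr 1; push_cast; ring

theorem pow_mul_of_mul_eq {A : Type*} [Ring A] [Algebra Zq A] {x y : A} {c : ℤ}
    (h : x * y = qpow c • (y * x)) (m : ℕ) : x ^ m * y = qpow (m * c) • (y * x ^ m) := by
  induction m with
  | zero => simp
  | succ m ih =>
    rw [pow_succ, mul_assoc, h, mul_smul_comm, ← mul_assoc, ih, smul_mul_assoc, mul_assoc,
      qpow_smul_qpow_smul]
    congr 2; push_cast; ring

theorem pow_mul_pow_of_mul_eq {A : Type*} [Ring A] [Algebra Zq A] {x y : A} {c : ℤ}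
    (h : x * y = qpow c • (y * x)) (m k : ℕ) :
    x ^ m * y ^ k = qpow (m * k * c) • (y ^ k * x ^ m) := by
  have h' := pow_mul_of_mul_eq h m
  have h2 : y * x ^ m = qpow (-(m * c)) • (x ^ m * y) := by
    rw [h', qpow_smul_qpow_smul, neg_add_cancel, qpow_zero_smul]
  rw [pow_mul_of_mul_eq h2 k, qpow_smul_qpow_smul]
  rw [show (m * k * c + k * -(m * c) : ℤ) = 0 by ring, qpow_zero_smul]

/-! ### Straightening in the `2 × 2` algebra and the product of two crossings. -/

theorem gen_zero_zero_mul : (gen 0 0 : Oq 2) * (gen 1 0 * gen 0 1)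
    = qpow 2 • (gen 1 0 * gen 0 1 * gen 0 0) := by
  have hx := isManin_gen 2
  have h1 := hx.col 0 1 0 (by decide)
  have h2 := hx.row 0 1 0 (by decide)
  rw [← mul_assoc, h1, smul_mul_assoc, mul_assoc, mul_assoc, h2, mul_smul_comm,
    qpow_smul_qpow_smul]
  norm_num

theorem gen_one_one_mul : (gen 1 1 : Oq 2) * (gen 1 0 * gen 0 1)
    = qpow (-2) • (gen 1 0 * gen 0 1 * gen 1 1) := by
  have hx := isManin_gen 2
  have h1 := hx.row 1 1 0 (by decide)
  have h2 := hx.col 0 1 1 (by decide)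
  rw [← mul_assoc, h1, smul_mul_assoc, mul_assoc, mul_assoc, h2, mul_smul_comm,
    qpow_smul_qpow_smul]
  norm_num

/-- Each further factor `x₀₀` on the right contributes one new correction term and multiplies the
old ones by `q⁻²`, the cost of moving it past `x₁₀ x₀₁`. -/
theorem gen_one_one_mul_gen_zero_zero_pow (m : ℕ) :
    (gen 1 1 : Oq 2) * gen 0 0 ^ (m + 1) = gen 0 0 ^ (m + 1) * gen 1 1 +
      ((qpow (-1) - qpow 1) * (qpow (-m) * qInt (m + 1))) •
        (gen 0 0 ^ m * (gen 1 0 * gen 0 1)) := by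
  have hx := (isManin_gen 2).cross 1 0 1 0 (by decide) (by decide)
  have hq' : hq = -(qpow (-1) - qpow 1) := by rw [hq]; ring
  induction m with
  | zero =>
    rw [zero_add, pow_one, hx, pow_zero, one_mul, hq', neg_smul, sub_neg_eq_add]
    simp [qInt]
  | succ m ih =>
    have hz : (gen 1 0 * gen 0 1 : Oq 2) * gen 0 0
        = qpow (-2) • (gen 0 0 * (gen 1 0 * gen 0 1)) := by
      rw [gen_zero_zero_mul, qpow_smul_qpow_smul, neg_add_cancel, qpow_zero_smul]
    rw [pow_succ, ← mul_assoc, ih, add_mul, mul_assoc _ (gen 1 1), hx, smul_mul_assoc, mul_assoc,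
      hz, qpow_neg_mul_qInt_succ_succ, mul_smul_comm, ← mul_assoc (gen 0 0 ^ m), ← pow_succ, hq',
      mul_sub, mul_smul_comm, ← mul_assoc, ← pow_succ]
    module

/-- One `x₁₁` is moved through `x₀₀^{s+1}`: the term ending in `x₁₁` is annihilated, and the other
yields `x₁₀ x₀₁`. Moving that to the front costs `q^{2s}` from `x₀₀^s` and `q^{-2s}` from `x₁₁^s`,
which cancel. The exponents `c` and `d` grow by one each time, so they are generalized. -/
theorem apply_gen_pow_straighten {f : Oq 2 →ₗ[Zq] Zq} (hf : KillsRight f (gen 1 1)) (s c d : ℕ) :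
    f (gen 1 0 ^ d * gen 0 1 ^ c * (gen 1 1 ^ s * gen 0 0 ^ s))
      = qpow (-((s : ℤ) * ((s : ℤ) - 1) / 2)) * (qpow (-1) - qpow 1) ^ s * qFactorial s *
        f (gen 1 0 ^ (d + s) * gen 0 1 ^ (c + s)) := by
  induction s generalizing c d with
  | zero => simp [qFactorial]
  | succ s ih =>
    have hc : Commute (gen 0 1 : Oq 2) (gen 1 0) :=
      (isManin_gen 2).comm 0 1 1 0 (by decide) (by decide)
    have e1 : (gen 1 1 : Oq 2) ^ (s + 1) * gen 0 0 ^ (s + 1)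
        = gen 1 1 ^ s * gen 0 0 ^ (s + 1) * gen 1 1
          + ((qpow (-1) - qpow 1) * (qpow (-s) * qInt (s + 1))) •
            (gen 1 0 * gen 0 1 * (gen 1 1 ^ s * gen 0 0 ^ s)) := by
      rw [pow_succ (gen 1 1), mul_assoc, gen_one_one_mul_gen_zero_zero_pow, mul_add, mul_smul_comm,
        pow_mul_of_mul_eq gen_zero_zero_mul, mul_smul_comm, ← mul_assoc _ (gen 1 0 * gen 0 1),
        pow_mul_of_mul_eq gen_one_one_mul, smul_mul_assoc, qpow_smul_qpow_smul, mul_assoc,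
        mul_assoc, show (s * 2 + s * -2 : ℤ) = 0 by ring, qpow_zero_smul]
      simp only [mul_assoc]
    have e2 : (gen 1 0 : Oq 2) ^ d * gen 0 1 ^ c * (gen 1 0 * gen 0 1 * (gen 1 1 ^ s * gen 0 0 ^ s))
        = gen 1 0 ^ (d + 1) * gen 0 1 ^ (c + 1) * (gen 1 1 ^ s * gen 0 0 ^ s) := by
      rw [pow_succ, pow_succ]
      simp only [mul_assoc]
      rw [← mul_assoc (gen 0 1 ^ c) (gen 1 0), (hc.pow_left c).eq, mul_assoc]
    -- The triangular exponent grows by `s`; the integer division is handled by writing the new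
    -- numerator as the old one plus `2s`.
    have e3 : qpow (-((s + 1 : ℕ) * ((s + 1 : ℕ) - 1) / 2 : ℤ))
        = qpow (-((s : ℤ) * ((s : ℤ) - 1) / 2)) * qpow (-s) := by
      rw [← LaurentPolynomial.T_add]
      congr 1
      rw [show ((s + 1 : ℕ) * ((s + 1 : ℕ) - 1) : ℤ) = s * (s - 1) + s * 2 by push_cast; ring,
        Int.add_mul_ediv_right _ _ (by norm_num)]
      ring
    rw [e1, mul_add, map_add, ← mul_assoc, hf, zero_add, mul_smul_comm, map_smul, e2, ih, e3,
      qFactorial, qFactorial, Finset.prod_range_succ, smul_eq_mul, add_right_comm, add_assoc d,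
      add_right_comm c, add_assoc c, pow_succ]
    ring

/-- The structure constants of the product of two crossings. -/
theorem structConst_crossing (s c d : ℕ) :
    structConst !![0, c + s; s + d, 0] !![0, s + d; c + s, 0] !![c, s; s, d]
      = qpow (-((s : ℤ) * ((s : ℤ) - 1) / 2) - (s : ℤ) * (c + d)) * (qpow (-1) - qpow 1) ^ s *
        qFactorial s := by
  set f := dualMonomial (n := 2) !![0, c + s; s + d, 0]
  set g := dualMonomial (n := 2) !![0, s + d; c + s, 0]
  have hf : KillsRight f (gen 1 1) := by
    simpa using killsRight_dualMonomial 2 2 (A := !![0, c + s; s + d, 0]) (i := 1) (j := 1) (m := 1)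
      (fun i j h => by omega) (by simp) (by simp) (by simp) (by simp)
  have hg : KillsRight g (gen 1 1) := by
    simpa using killsRight_dualMonomial 2 2 (A := !![0, s + d; c + s, 0]) (i := 1) (j := 1) (m := 1)
      (fun i j h => by omega) (by simp) (by simp) (by simp) (by simp)
  have hg' : KillsLeft g (gen 0 0) := by
    simpa using killsLeft_dualMonomial (A := !![0, s + d; c + s, 0]) (i := 0) (j := 0) (m := 1)
      (fun k l h => by simp) (by simp)
  rw [structConst_eq, normalMonomial_two]
  simp only [map_mul, map_pow, Matrix.of_apply, Matrix.cons_val', Matrix.cons_val_zero,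
    Matrix.cons_val_one, Matrix.cons_val_fin_one]
  change pairing f g _ = _
  -- In column 0 the term through index 0 dies because `g` annihilates `x₀₀` from the left; in
  -- column 1 the term through index 1 dies because `g` annihilates `x₁₁` from the right.
  have e1 : pairing f g (comul 2 (gen 1 0) ^ s * comul 2 (gen 0 0) ^ c *
      (comul 2 (gen 1 1) ^ d * comul 2 (gen 0 1) ^ s))
      = f (gen 1 1 ^ s * gen 0 1 ^ c * (gen 1 0 ^ d * gen 0 0 ^ s)) *
        g (gen 1 0 ^ s * gen 1 0 ^ c * (gen 0 1 ^ d * gen 0 1 ^ s)) := by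
    have h1 := pairing_comul_pow_left (f := f) (g := g) 1 (i := 1) (j := 0) (P := 1) (Q := 1)
      (by
        simp only [Fin.forall_fin_two]
        refine ⟨fun _ m => Or.inr ?_, by simp⟩
        rw [one_mul]
        exact hg'.qCommute_pow' (qCommute_gen_col _ _ _) m) s
      (comul 2 (gen 0 0) ^ c * (comul 2 (gen 1 1) ^ d * comul 2 (gen 0 1) ^ s))
    have h2 := pairing_comul_pow_left (f := f) (g := g) 1 (i := 0) (j := 0)
      (P := gen 1 1 ^ s) (Q := gen 1 0 ^ s)
      (by
        simp only [Fin.forall_fin_two]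
        refine ⟨fun _ m => Or.inr ?_, by simp⟩
        exact (hg'.qCommute_pow' (qCommute_gen_col _ _ _) s).qCommute_pow
          (qCommute_gen_col _ _ _) m) c
      (comul 2 (gen 1 1) ^ d * comul 2 (gen 0 1) ^ s)
    have h3 := pairing_comul_pow_right (f := f) (g := g) 0 (i := 0) (j := 1) (P := 1) (Q := 1)
      (by
        simp only [Fin.forall_fin_two]
        refine ⟨by simp, fun _ m => Or.inr ?_⟩
        rw [mul_one]
        exact hg.qCommute_pow' (qCommute_gen_col _ _ _) m) s
      ((gen 1 1 ^ s * gen 0 1 ^ c) ⊗ₜ (gen 1 0 ^ s * gen 1 0 ^ c) * comul 2 (gen 1 1) ^ d)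
    have h4 := pairing_comul_pow_right (f := f) (g := g) 0 (i := 1) (j := 1)
      (P := gen 0 0 ^ s) (Q := gen 0 1 ^ s)
      (by
        simp only [Fin.forall_fin_two]
        refine ⟨by simp, fun _ m => Or.inr ?_⟩
        exact (hg.qCommute_pow' (qCommute_gen_col _ _ _) s).qCommute_pow
          (qCommute_gen_col _ _ _) m) d
      ((gen 1 1 ^ s * gen 0 1 ^ c) ⊗ₜ (gen 1 0 ^ s * gen 1 0 ^ c))
    simp only [one_mul, mul_one, ← Algebra.TensorProduct.one_def] at h1 h3
    rw [mul_assoc, h1, ← mul_assoc, h2, ← mul_assoc, h3, mul_assoc, h4,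
      Algebra.TensorProduct.tmul_mul_tmul, pairing_tmul]
  have hcol := (isManin_gen 2).col 0 1 1 (by decide)
  have hcol' : (gen 1 1 : Oq 2) * gen 0 1 = qpow (-1) • (gen 0 1 * gen 1 1) := by
    rw [hcol, qpow_smul_qpow_smul, neg_add_cancel, qpow_zero_smul]
  have hrow := (isManin_gen 2).row 1 1 0 (by decide)
  have hc : Commute (gen 0 1 : Oq 2) (gen 1 0) :=
    (isManin_gen 2).comm 0 1 1 0 (by decide) (by decide)
  -- Passing `x₀₁^c` costs `q^{-sc}` and passing `x₁₀^d` costs `q^{-sd}`.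
  have e2 : (gen 1 1 ^ s * gen 0 1 ^ c * (gen 1 0 ^ d * gen 0 0 ^ s) : Oq 2)
      = qpow (-(s * (c + d))) • (gen 1 0 ^ d * gen 0 1 ^ c * (gen 1 1 ^ s * gen 0 0 ^ s)) := by
    rw [pow_mul_pow_of_mul_eq hcol', smul_mul_assoc, mul_assoc (gen 0 1 ^ c),
      ← mul_assoc (gen 1 1 ^ s) (gen 1 0 ^ d),
      pow_mul_pow_of_mul_eq hrow, smul_mul_assoc, mul_smul_comm, qpow_smul_qpow_smul,
      mul_assoc (gen 1 0 ^ d), ← mul_assoc (gen 0 1 ^ c), (hc.pow_pow c d).eq, mul_assoc]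
    congr 2
    ring
  have hf1 : f (gen 1 0 ^ (d + s) * gen 0 1 ^ (c + s)) = 1 := by
    have := dualMonomial_normalMonomial (n := 2) !![0, c + s; s + d, 0] !![0, c + s; s + d, 0]
    rw [normalMonomial_two, if_pos rfl] at this
    simpa [f, add_comm s d] using this
  have hg1 : g (gen 1 0 ^ s * gen 1 0 ^ c * (gen 0 1 ^ d * gen 0 1 ^ s)) = 1 := by
    have := dualMonomial_normalMonomial (n := 2) !![0, s + d; c + s, 0] !![0, s + d; c + s, 0]
    rw [normalMonomial_two, if_pos rfl] at this
    simpa [g, ← pow_add, add_comm s d, add_comm c s] using this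
  rw [e1, e2, map_smul, apply_gen_pow_straighten hf, hf1, hg1, smul_eq_mul,
    sub_eq_add_neg (-((s : ℤ) * ((s : ℤ) - 1) / 2)), qpow_add]
  ring


/-! ### Structure constants in `𝒪_q(4)` for the double coset diagram. -/

theorem killsLeft_four {A : Matrix (Fin 4) (Fin 4) ℕ} {i j : Fin 4} (hij : i = 0 ∨ j = 0)
    (h : A i j = 0) : KillsLeft (dualMonomial A) (gen i j) := by
  rw [← pow_one (gen i j)]
  refine killsLeft_dualMonomial (fun k l hk hl => ?_) (by omega)
  rcases hij with rfl | rfl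
  · exact absurd hk (Fin.not_lt_zero k)
  · exact absurd hl (Fin.not_lt_zero l)

/-- The structure constants of the product of the crossing of two inner strings with two splits. -/
theorem structConst_crossing_split (p s t : ℕ) (c d : Fin 4 → ℕ) (h0 : c 0 + d 0 = p)
    (h1 : c 1 + d 1 = s) (h2 : c 2 + d 2 = s) (h3 : c 3 + d 3 = t)
    (hc : c 0 + c 1 + c 2 + c 3 = p + s) :
    structConst !![p, 0, 0, 0; 0, 0, s, 0; 0, s, 0, 0; 0, 0, 0, t]
        !![p, 0, 0, 0; s, 0, 0, 0; 0, s, 0, 0; 0, t, 0, 0]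
        !![c 0, d 0, 0, 0; c 1, d 1, 0, 0; c 2, d 2, 0, 0; c 3, d 3, 0, 0]
      = if c 0 = p ∧ c 1 = 0 ∧ c 2 = s ∧ c 3 = 0 then 1 else 0 := by
  set M : Matrix (Fin 4) (Fin 4) ℕ := !![p, 0, 0, 0; 0, 0, s, 0; 0, s, 0, 0; 0, 0, 0, t] with hM
  set S : Matrix (Fin 4) (Fin 4) ℕ := !![p, 0, 0, 0; s, 0, 0, 0; 0, s, 0, 0; 0, t, 0, 0] with hS
  set f := dualMonomial M with hf
  set g := dualMonomial S with hg
  have f10 : KillsLeft f (gen 1 0) := killsLeft_four (.inr rfl) (by simp [hM])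
  have f20 : KillsLeft f (gen 2 0) := killsLeft_four (.inr rfl) (by simp [hM])
  have f30 : KillsLeft f (gen 3 0) := killsLeft_four (.inr rfl) (by simp [hM])
  have g20 : KillsLeft g (gen 2 0) := killsLeft_four (.inr rfl) (by simp [hS])
  have g30 : KillsLeft g (gen 3 0) := killsLeft_four (.inr rfl) (by simp [hS])
  have g10 : KillsLeft g (gen 1 0 ^ (s + 1)) :=
    killsLeft_dualMonomial (fun k l _ => Fin.not_lt_zero l) (by simp [hS])
  have f03 : KillsRight f (gen 0 3) := by
    simpa using killsRight_dualMonomial 4 4 (A := M) (i := 0) (j := 3) (m := 1)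
      (fun i j h => by omega) (by simp) (by simp) (by simp) (by simp [hM])
  have f13 : KillsRight f (gen 1 3) := by
    simpa using killsRight_dualMonomial 4 4 (A := M) (i := 1) (j := 3) (m := 1)
      (fun i j h => by omega) (by simp) (by simp) (by simp) (by simp [hM])
  have f23 : KillsRight f (gen 2 3) := by
    simpa using killsRight_dualMonomial 4 4 (A := M) (i := 2) (j := 3) (m := 1)
      (fun i j h => by omega) (by simp) (by simp) (by simp) (by simp [hM])
  have hbox : ∀ i j : Fin 4, ¬ ((i : ℕ) < 4 ∧ (j : ℕ) < 2) → S i j = 0 := by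
    intro i j h
    fin_cases j <;> fin_cases i <;> simp [hS] at h ⊢
  have g01 : KillsRight g (gen 0 1) := by
    simpa using killsRight_dualMonomial 4 2 (A := S) (i := 0) (j := 1) (m := 1)
      hbox (by simp) (by simp) (by simp) (by simp [hS])
  have g11 : KillsRight g (gen 1 1) := by
    simpa using killsRight_dualMonomial 4 2 (A := S) (i := 1) (j := 1) (m := 1)
      hbox (by simp) (by simp) (by simp) (by simp [hS])
  have g21 : KillsRight g (gen 2 1 ^ (s + 1)) :=
    killsRight_dualMonomial 4 2 (A := S) (i := 2) (j := 1)
      hbox (by simp) (by simp) (by simp) (by simp [hS])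
  have row := qCommute_gen_row (n := 4)
  have col := qCommute_gen_col (n := 4)
  -- Column 0 of `C` is processed from the left and column 1 from the right. The zeros of `M` and
  -- `S` leave one intermediate index each time: 1 for `x₃₀, x₂₀, x₁₀`, 2 for `x₀₁, x₁₁, x₂₁`, while
  -- `x₀₀` and `x₃₁` need a count of exponents to single out 0 and 3.
  have e1 : structConst M S !![c 0, d 0, 0, 0; c 1, d 1, 0, 0; c 2, d 2, 0, 0; c 3, d 3, 0, 0]
      = f (gen 3 1 ^ c 3 * gen 2 1 ^ c 2 * gen 1 1 ^ c 1 * gen 0 0 ^ c 0 *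
          (gen 3 3 ^ d 3 * (gen 2 2 ^ d 2 * (gen 1 2 ^ d 1 * gen 0 2 ^ d 0)))) *
        g (gen 1 0 ^ c 3 * gen 1 0 ^ c 2 * gen 1 0 ^ c 1 * gen 0 0 ^ c 0 *
          (gen 3 1 ^ d 3 * (gen 2 1 ^ d 2 * (gen 2 1 ^ d 1 * gen 2 1 ^ d 0)))) := by
    have l3 := pairing_comul_pow_left (f := f) (g := g) 1 (i := 3) (j := 0) (P := 1) (Q := 1)
      (by
        intro k hk m
        rw [one_mul, one_mul]
        fin_cases k
        · exact .inl (f30.qCommute_pow' (row _ _ _) m)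
        · exact absurd rfl hk
        · exact .inr (g20.qCommute_pow' (col _ _ _) m)
        · exact .inr (g30.qCommute_pow' (col _ _ _) m)) (c 3)
    have l2 := pairing_comul_pow_left (f := f) (g := g) 1 (i := 2) (j := 0)
      (P := gen 3 1 ^ c 3) (Q := gen 1 0 ^ c 3)
      (by
        intro k hk m
        fin_cases k
        · refine .inl (KillsLeft.qCommute_pow ?_ (row _ _ _) m)
          simpa using KillsLeft.cross_pow (p := 1) (i := 3) (j := 1) (k := 2) (l := 0) (by decide)
            (by decide) (by simpa using f20) (by simpa using f30) (c 3)
        · exact absurd rfl hk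
        · exact .inr ((g20.qCommute_pow' (col _ _ _) _).qCommute_pow (col _ _ _) m)
        · exact .inr ((g30.qCommute_pow' (col _ _ _) _).qCommute_pow (col _ _ _) m)) (c 2)
    have l1 := pairing_comul_pow_left (f := f) (g := g) 1 (i := 1) (j := 0)
      (P := gen 3 1 ^ c 3 * gen 2 1 ^ c 2) (Q := gen 1 0 ^ c 3 * gen 1 0 ^ c 2)
      (by
        intro k hk m
        fin_cases k
        · refine .inl (KillsLeft.qCommute_pow (KillsLeft.cross_pow (by decide) (by decide) ?_ ?_ _)
            (row _ _ _) m)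
          · simpa using KillsLeft.cross_pow (p := 1) (i := 3) (j := 1) (k := 1) (l := 0)
              (by decide) (by decide) (by simpa using f10) (by simpa using f30) (c 3)
          · simpa using KillsLeft.cross_pow (p := 1) (i := 3) (j := 1) (k := 2) (l := 0)
              (by decide) (by decide) (by simpa using f20) (by simpa using f30) (c 3)
        · exact absurd rfl hk
        · exact .inr (((g20.qCommute_pow' (col _ _ _) _).qCommute_pow (col _ _ _) _).qCommute_pow
            (col _ _ _) m)
        · exact .inr (((g30.qCommute_pow' (col _ _ _) _).qCommute_pow (col _ _ _) _).qCommute_pow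
            (col _ _ _) m)) (c 1)
    have l0 := pairing_comul_pow_left (f := f) (g := g) 0 (i := 0) (j := 0)
      (P := gen 3 1 ^ c 3 * gen 2 1 ^ c 2 * gen 1 1 ^ c 1)
      (Q := gen 1 0 ^ c 3 * gen 1 0 ^ c 2 * gen 1 0 ^ c 1)
      (by
        intro k hk m
        refine .inr (KillsLeft.qCommute_pow ?_ (col _ _ _) m)
        fin_cases k
        · exact absurd rfl hk
        -- As `c 0 ≤ p`, the other entries of column 0 sum to at least `s`; one more `x₁₀` exceeds
        -- the exponent `s` allowed by `S`.
        · obtain ⟨r, hr⟩ : ∃ r, c 3 + c 2 + c 1 + 1 = s + 1 + r :=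
            ⟨c 3 + c 2 + c 1 - s, by omega⟩
          simp only [← pow_add]
          change KillsLeft g (_ * gen 1 0)
          rw [← pow_succ, hr, pow_add]
          exact g10.mul_right _
        · exact ((g20.qCommute_pow' (col _ _ _) _).qCommute_pow (col _ _ _) _).qCommute_pow
            (col _ _ _) _
        · exact ((g30.qCommute_pow' (col _ _ _) _).qCommute_pow (col _ _ _) _).qCommute_pow
            (col _ _ _) _) (c 0)
    have r0 := pairing_comul_pow_right (f := f) (g := g) 2 (i := 0) (j := 1) (P := 1) (Q := 1)
      (by
        intro k hk m
        rw [mul_one, mul_one]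
        fin_cases k
        · exact .inr (g01.qCommute_pow' (col _ _ _) m)
        · exact .inr (g11.qCommute_pow' (col _ _ _) m)
        · exact absurd rfl hk
        · exact .inl (f03.qCommute_pow' (row _ _ _) m)) (d 0)
    have r1 := pairing_comul_pow_right (f := f) (g := g) 2 (i := 1) (j := 1)
      (P := gen 0 2 ^ d 0) (Q := gen 2 1 ^ d 0)
      (by
        intro k hk m
        fin_cases k
        · exact .inr ((g01.qCommute_pow' (col _ _ _) _).qCommute_pow (col _ _ _) m)
        · exact .inr ((g11.qCommute_pow' (col _ _ _) _).qCommute_pow (col _ _ _) m)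
        · exact absurd rfl hk
        · refine .inl (KillsRight.qCommute_pow ?_ (row _ _ _) m)
          simpa using KillsRight.cross_pow (s := 1) (i := 1) (j := 3) (k := 0) (l := 2) (by decide)
            (by decide) (by simpa using f13) (by simpa using f03) (d 0)) (d 1)
    have r2 := pairing_comul_pow_right (f := f) (g := g) 2 (i := 2) (j := 1)
      (P := gen 1 2 ^ d 1 * gen 0 2 ^ d 0) (Q := gen 2 1 ^ d 1 * gen 2 1 ^ d 0)
      (by
        intro k hk m
        fin_cases k
        · rw [← pow_add (gen 2 1)]
          exact .inr ((g01.qCommute_pow' (col _ _ _) _).qCommute_pow (col _ _ _) m)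
        · rw [← pow_add (gen 2 1)]
          exact .inr ((g11.qCommute_pow' (col _ _ _) _).qCommute_pow (col _ _ _) m)
        · exact absurd rfl hk
        · refine .inl (KillsRight.qCommute_pow ?_ (row _ _ _) m)
          change KillsRight f (gen 2 3 * _)
          rw [← mul_assoc]
          refine KillsRight.cross_pow (by decide) (by decide) ?_ ?_ _
          · simpa using KillsRight.cross_pow (s := 1) (i := 2) (j := 3) (k := 0) (l := 2)
              (by decide) (by decide) (by simpa using f23) (by simpa using f03) (d 0)
          · simpa using KillsRight.cross_pow (s := 1) (i := 1) (j := 3) (k := 0) (l := 2)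
              (by decide) (by decide) (by simpa using f13) (by simpa using f03) (d 0)) (d 2)
    have r3 := pairing_comul_pow_right (f := f) (g := g) 3 (i := 3) (j := 1)
      (P := gen 2 2 ^ d 2 * (gen 1 2 ^ d 1 * gen 0 2 ^ d 0))
      (Q := gen 2 1 ^ d 2 * (gen 2 1 ^ d 1 * gen 2 1 ^ d 0))
      (by
        intro k hk m
        refine .inr (KillsRight.qCommute_pow ?_ (col _ _ _) m)
        rw [← pow_add, ← pow_add]
        fin_cases k
        · exact g01.qCommute_pow' (col _ _ _) _
        · exact g11.qCommute_pow' (col _ _ _) _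
        -- Likewise `d 0 + d 1 + d 2 = s + c 3` is at least `s`.
        · obtain ⟨r, hr⟩ : ∃ r, d 2 + (d 1 + d 0) + 1 = r + (s + 1) :=
            ⟨d 2 + (d 1 + d 0) - s, by omega⟩
          change KillsRight g (gen 2 1 * _)
          rw [← pow_succ', hr, pow_add]
          exact g21.mul_left _
        · exact absurd rfl hk) (d 3)
    simp only [one_mul, mul_one, ← Algebra.TensorProduct.one_def] at l3 r0
    rw [structConst_eq, normalMonomial_four]
    simp only [map_mul, map_pow, Matrix.of_apply, Matrix.cons_val', Matrix.cons_val_zero,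
      Matrix.cons_val_one, Matrix.cons_val_fin_one, Matrix.cons_val, pow_zero, mul_one]
    change pairing f g _ = _
    rw [mul_assoc, l3, mul_assoc, ← mul_assoc, l2, mul_assoc, ← mul_assoc, l1, ← mul_assoc, l0]
    have a := @mul_assoc (Oq 4 ⊗[Zq] Oq 4) _
    rw [← a _ _ (comul 4 (gen 0 1) ^ d 0), ← a _ _ (comul 4 (gen 0 1) ^ d 0),
      ← a _ _ (comul 4 (gen 0 1) ^ d 0), r0, ← a _ _ (comul 4 (gen 1 1) ^ d 1),
      ← a _ _ (comul 4 (gen 1 1) ^ d 1), a _ (comul 4 (gen 1 1) ^ d 1), r1,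
      ← a _ _ (comul 4 (gen 2 1) ^ d 2), a _ (comul 4 (gen 2 1) ^ d 2), r2, a, r3,
      Algebra.TensorProduct.tmul_mul_tmul, pairing_tmul]
  rw [e1]
  -- The argument of `g` is already normally ordered. Equality with `x_S` forces `c 3 = 0` and `d 0
  -- = 0`, leaving `c 2` as the only parameter.
  have e2 : g (gen 1 0 ^ c 3 * gen 1 0 ^ c 2 * gen 1 0 ^ c 1 * gen 0 0 ^ c 0 *
          (gen 3 1 ^ d 3 * (gen 2 1 ^ d 2 * (gen 2 1 ^ d 1 * gen 2 1 ^ d 0))))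
      = if c 0 = p ∧ d 3 = t then 1 else 0 := by
    have := dualMonomial_normalMonomial (n := 4) S !![c 0, 0, 0, 0; c 3 + c 2 + c 1, 0, 0, 0;
      0, d 2 + (d 1 + d 0), 0, 0; 0, d 3, 0, 0]
    rw [normalMonomial_four] at this
    simp only [Matrix.of_apply, Matrix.cons_val', Matrix.cons_val_zero,
      Matrix.cons_val_one, Matrix.cons_val_fin_one, Matrix.cons_val, pow_zero, mul_one,
      one_mul] at this
    rw [← pow_add, ← pow_add, ← pow_add, ← pow_add, mul_assoc (gen 1 0 ^ _)]
    refine (congrArg g (by simp only [mul_assoc])).trans (this.trans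
      (if_congr ⟨fun h => ?_, fun h => ?_⟩ rfl rfl))
    · have h1 := congrFun (congrFun h 0) 0
      have h2 := congrFun (congrFun h 3) 1
      simpa [hS] using And.intro h1 h2
    · rw [show c 3 + c 2 + c 1 = s by omega, show d 2 + (d 1 + d 0) = s by omega, h.1, h.2]
  rw [e2]
  by_cases hcd : c 0 = p ∧ d 3 = t
  swap
  · rw [if_neg hcd, mul_zero, if_neg]
    omega
  rw [if_pos hcd, mul_one, show c 3 = 0 by omega, show d 0 = 0 by omega,
    show c 1 = s - c 2 by omega, show d 1 = c 2 by omega, show d 2 = s - c 2 by omega, hcd.1, hcd.2,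
    pow_zero, pow_zero, one_mul, mul_one]
  -- For normal order, `x₀₀^p` must move to the front and `x₃₃^t` to the end. The errors lie in
  -- right ideals of `x₁₀, x₂₀` and left ideals of `x₁₃, x₂₃`, possibly behind or before a further
  -- power, and `f` annihilates all of them.
  obtain ⟨r1, hr1⟩ := gen_pow_mul_gen_pow_left (n := 4) (i := 1) (j := 1) (k := 0) (l := 0)
    (by decide) (by decide) (.inl rfl) (s - c 2) p
  obtain ⟨r2, hr2⟩ := gen_pow_mul_gen_pow_left (n := 4) (i := 2) (j := 1) (k := 0) (l := 0)
    (by decide) (by decide) (.inl rfl) (c 2) p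
  obtain ⟨r3, hr3⟩ := gen_pow_mul_gen_pow_right (n := 4) (i := 3) (j := 3) (k := 2) (l := 2)
    (by decide) (by decide) (.inr rfl) t (s - c 2)
  obtain ⟨r4, hr4⟩ := gen_pow_mul_gen_pow_right (n := 4) (i := 3) (j := 3) (k := 1) (l := 2)
    (by decide) (by decide) (.inr rfl) t (c 2)
  have k1 : KillsLeft f (gen 2 1 ^ c 2 * gen 1 0) := by
    simpa using KillsLeft.cross_pow (p := 1) (i := 2) (j := 1) (k := 1) (l := 0) (by decide)
      (by decide) (by simpa using f10) (by simpa using f20) (c 2)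
  have k2 : KillsRight f (gen 2 3 * gen 1 2 ^ c 2) := by
    simpa using KillsRight.cross_pow (s := 1) (i := 2) (j := 3) (k := 1) (l := 2) (by decide)
      (by decide) (by simpa using f23) (by simpa using f13) (c 2)
  have s1 : ∀ w, f (gen 2 1 ^ c 2 * gen 1 1 ^ (s - c 2) * gen 0 0 ^ p * w)
      = f (gen 0 0 ^ p * gen 2 1 ^ c 2 * gen 1 1 ^ (s - c 2) * w) := by
    intro w
    have e : gen 2 1 ^ c 2 * gen 1 1 ^ (s - c 2) * gen 0 0 ^ p * w
        = gen 0 0 ^ p * gen 2 1 ^ c 2 * gen 1 1 ^ (s - c 2) * w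
          + gen 2 0 * (r2 * gen 1 1 ^ (s - c 2) * w) + gen 2 1 ^ c 2 * gen 1 0 * (r1 * w) := by
      rw [mul_assoc (gen 2 1 ^ c 2), hr1, mul_add, ← mul_assoc (gen 2 1 ^ c 2), hr2]
      noncomm_ring
    rw [e, map_add, map_add, f20, k1, add_zero, add_zero]
  have s2 : ∀ w, f (w * (gen 3 3 ^ t * (gen 2 2 ^ (s - c 2) * gen 1 2 ^ c 2)))
      = f (w * (gen 2 2 ^ (s - c 2) * gen 1 2 ^ c 2 * gen 3 3 ^ t)) := by
    intro w
    have e : w * (gen 3 3 ^ t * (gen 2 2 ^ (s - c 2) * gen 1 2 ^ c 2))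
        = w * (gen 2 2 ^ (s - c 2) * gen 1 2 ^ c 2 * gen 3 3 ^ t)
          + w * gen 2 2 ^ (s - c 2) * r4 * gen 1 3 + w * r3 * (gen 2 3 * gen 1 2 ^ c 2) := by
      rw [← mul_assoc (gen 3 3 ^ t), hr3, add_mul, mul_assoc _ (gen 3 3 ^ t), hr4]
      noncomm_ring
    rw [e, map_add, map_add, f13, k2, add_zero, add_zero]
  rw [s1, s2]
  have := dualMonomial_normalMonomial (n := 4) M !![p, 0, 0, 0; 0, s - c 2, c 2, 0;
      0, c 2, s - c 2, 0; 0, 0, 0, t]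
  rw [normalMonomial_four] at this
  simp only [Matrix.of_apply, Matrix.cons_val', Matrix.cons_val_zero,
    Matrix.cons_val_one, Matrix.cons_val_fin_one, Matrix.cons_val, pow_zero, mul_one,
    one_mul] at this
  refine (congrArg f (by simp only [mul_assoc])).trans (this.trans
    (if_congr ⟨fun h => ?_, fun h => ?_⟩ rfl rfl))
  · have h1 := congrFun (congrFun h 2) 1
    simp [hM] at h1
    omega
  · obtain ⟨-, -, h, -⟩ := h
    rw [h, Nat.sub_self]


/-- The structure constants of the product of two merges with the crossing of the inner strings of two
splits. -/
theorem structConst_merge (p s t c d r : ℕ) (hc : c + r = p + s) (hd : r + d = s + t) :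
    structConst !![p, s, 0, 0; 0, 0, s, t; 0, 0, 0, 0; 0, 0, 0, 0]
        !![p, 0, 0, 0; 0, s, 0, 0; s, 0, 0, 0; 0, t, 0, 0]
        !![c, r, 0, 0; r, d, 0, 0; 0, 0, 0, 0; 0, 0, 0, 0]
      = if r = s then 1 else 0 := by
  set M : Matrix (Fin 4) (Fin 4) ℕ := !![p, s, 0, 0; 0, 0, s, t; 0, 0, 0, 0; 0, 0, 0, 0] with hM
  set S : Matrix (Fin 4) (Fin 4) ℕ := !![p, 0, 0, 0; 0, s, 0, 0; s, 0, 0, 0; 0, t, 0, 0] with hS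
  set f := dualMonomial M
  set g := dualMonomial S
  have f10 : KillsLeft f (gen 1 0) := killsLeft_four (.inr rfl) (by simp [hM])
  have f02 : KillsLeft f (gen 0 2) := killsLeft_four (.inl rfl) (by simp [hM])
  have g10 : KillsLeft g (gen 1 0) := killsLeft_four (.inr rfl) (by simp [hS])
  have g30 : KillsLeft g (gen 3 0) := killsLeft_four (.inr rfl) (by simp [hS])
  have f03 : KillsRight f (gen 0 3) := by
    simpa using killsRight_dualMonomial 4 4 (A := M) (i := 0) (j := 3) (m := 1)
      (fun i j h => by omega) (by simp) (by simp) (by simp) (by simp [hM])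
  -- `M` is supported in its first two rows, and `(1, 1)` lies in the last row of that box.
  have f11 : KillsRight f (gen 1 1) := by
    simpa using killsRight_dualMonomial 2 4 (A := M) (i := 1) (j := 1) (m := 1)
      (fun i j h => by fin_cases i <;> fin_cases j <;> simp [hM] at h ⊢)
      (by simp) (by simp) (by simp) (by simp [hM])
  have hbox : ∀ i j : Fin 4, ¬ ((i : ℕ) < 4 ∧ (j : ℕ) < 2) → S i j = 0 := by
    intro i j h
    fin_cases j <;> fin_cases i <;> simp [hS] at h ⊢
  have g01 : KillsRight g (gen 0 1) := by
    simpa using killsRight_dualMonomial 4 2 (A := S) (i := 0) (j := 1) (m := 1)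
      hbox (by simp) (by simp) (by simp) (by simp [hS])
  have g21 : KillsRight g (gen 2 1) := by
    simpa using killsRight_dualMonomial 4 2 (A := S) (i := 2) (j := 1) (m := 1)
      hbox (by simp) (by simp) (by simp) (by simp [hS])
  have row := qCommute_gen_row (n := 4)
  have col := qCommute_gen_col (n := 4)
  -- The surviving intermediate indices are 2 for `x₁₀`, 0 for `x₀₀`, 1 for `x₀₁` and 3 for `x₁₁`.
  have e1 : structConst M S !![c, r, 0, 0; r, d, 0, 0; 0, 0, 0, 0; 0, 0, 0, 0]
      = f (gen 1 2 ^ r * gen 0 0 ^ c * (gen 1 3 ^ d * gen 0 1 ^ r)) *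
        g (gen 2 0 ^ r * gen 0 0 ^ c * (gen 3 1 ^ d * gen 1 1 ^ r)) := by
    have l1 := pairing_comul_pow_left (f := f) (g := g) 2 (i := 1) (j := 0) (P := 1) (Q := 1)
      (by
        intro k hk m
        rw [one_mul, one_mul]
        fin_cases k
        · exact .inl (f10.qCommute_pow' (row _ _ _) m)
        · exact .inr (g10.qCommute_pow' (col _ _ _) m)
        · exact absurd rfl hk
        · exact .inr (g30.qCommute_pow' (col _ _ _) m)) r
    have l0 := pairing_comul_pow_left (f := f) (g := g) 0 (i := 0) (j := 0)
      (P := gen 1 2 ^ r) (Q := gen 2 0 ^ r)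
      (by
        intro k hk m
        fin_cases k
        · exact absurd rfl hk
        · exact .inr ((g10.qCommute_pow' (col _ _ _) _).qCommute_pow (col _ _ _) m)
        · exact .inl ((f02.qCommute_pow' (col _ _ _) _).qCommute_pow (row _ _ _) m)
        · exact .inr ((g30.qCommute_pow' (col _ _ _) _).qCommute_pow (col _ _ _) m)) c
    have r0 := pairing_comul_pow_right (f := f) (g := g) 1 (i := 0) (j := 1) (P := 1) (Q := 1)
      (by
        intro k hk m
        rw [mul_one, mul_one]
        fin_cases k
        · exact .inr (g01.qCommute_pow' (col _ _ _) m)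
        · exact absurd rfl hk
        · exact .inr (g21.qCommute_pow' (col _ _ _) m)
        · exact .inl (f03.qCommute_pow' (row _ _ _) m)) r
    have r1 := pairing_comul_pow_right (f := f) (g := g) 3 (i := 1) (j := 1)
      (P := gen 0 1 ^ r) (Q := gen 1 1 ^ r)
      (by
        intro k hk m
        fin_cases k
        · exact .inr ((g01.qCommute_pow' (col _ _ _) _).qCommute_pow (col _ _ _) m)
        · exact .inl ((f11.qCommute_pow' (col _ _ _) _).qCommute_pow (row _ _ _) m)
        · exact .inr ((g21.qCommute_pow' (col _ _ _) _).qCommute_pow (col _ _ _) m)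
        · exact absurd rfl hk) d
    simp only [one_mul, mul_one, ← Algebra.TensorProduct.one_def] at l1 r0
    rw [structConst_eq, normalMonomial_four]
    simp only [map_mul, map_pow, Matrix.of_apply, Matrix.cons_val', Matrix.cons_val_zero,
      Matrix.cons_val_one, Matrix.cons_val_fin_one, Matrix.cons_val, pow_zero, mul_one, one_mul]
    change pairing f g _ = _
    rw [mul_assoc, l1, ← mul_assoc, l0, ← mul_assoc, r0, mul_assoc, r1,
      Algebra.TensorProduct.tmul_mul_tmul, pairing_tmul]
  rw [e1]
  have e2 : g (gen 2 0 ^ r * gen 0 0 ^ c * (gen 3 1 ^ d * gen 1 1 ^ r))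
      = if r = s then 1 else 0 := by
    have := dualMonomial_normalMonomial (n := 4) S
      !![c, 0, 0, 0; 0, r, 0, 0; r, 0, 0, 0; 0, d, 0, 0]
    rw [normalMonomial_four] at this
    simp only [Matrix.of_apply, Matrix.cons_val', Matrix.cons_val_zero,
      Matrix.cons_val_one, Matrix.cons_val_fin_one, Matrix.cons_val, pow_zero, mul_one,
      one_mul] at this
    refine this.trans (if_congr ⟨fun h => ?_, fun h => ?_⟩ rfl rfl)
    · simpa [hS] using congrFun (congrFun h 2) 0
    · rw [h, show c = p by omega, show d = t by omega]
  rw [e2]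
  split_ifs with hr
  swap
  · rw [mul_zero]
  obtain rfl : c = p := by omega
  obtain rfl : d = t := by omega
  subst hr
  rw [mul_one]
  obtain ⟨r1, hr1⟩ := gen_pow_mul_gen_pow_left (n := 4) (i := 1) (j := 2) (k := 0) (l := 0)
    (by decide) (by decide) (.inl rfl) r c
  obtain ⟨r2, hr2⟩ := gen_pow_mul_gen_pow_right (n := 4) (i := 1) (j := 3) (k := 0) (l := 1)
    (by decide) (by decide) (.inr rfl) d r
  obtain ⟨r3, hr3⟩ := gen_pow_mul_gen_pow_left (n := 4) (i := 1) (j := 2) (k := 0) (l := 1)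
    (by decide) (by decide) (.inr rfl) r r
  have k1 : KillsLeft f (gen 0 0 ^ c * gen 0 2) := f02.qCommute_pow' (row _ _ _) _
  -- Straightening to normal order exchanges three pairs of powers. Each error is arranged to carry
  -- `x₁₀` or `x₀₀^c x₀₂` in front, or `x₀₃` at the end, all annihilated by `f`.
  have e : gen 1 2 ^ r * gen 0 0 ^ c * (gen 1 3 ^ d * gen 0 1 ^ r)
      = gen 0 0 ^ c * gen 0 1 ^ r * gen 1 2 ^ r * gen 1 3 ^ d
        + gen 0 0 ^ c * gen 0 2 * (r3 * gen 1 3 ^ d) + gen 1 2 ^ r * gen 0 0 ^ c * r2 * gen 0 3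
        + gen 1 0 * (r1 * (gen 0 1 ^ r * gen 1 3 ^ d)) := by
    have h2 : gen 0 0 ^ c * gen 0 1 ^ r * gen 1 2 ^ r = gen 0 0 ^ c * (gen 1 2 ^ r * gen 0 1 ^ r)
        - gen 0 0 ^ c * gen 0 2 * r3 := by
      rw [hr3]; noncomm_ring
    have h1 : gen 0 0 ^ c * gen 1 2 ^ r = gen 1 2 ^ r * gen 0 0 ^ c - gen 1 0 * r1 := by
      rw [hr1]; noncomm_ring
    rw [hr2, h2, ← mul_assoc (gen 0 0 ^ c) (gen 1 2 ^ r), h1]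
    noncomm_ring
  rw [e, map_add, map_add, map_add, k1, f03, f10, add_zero, add_zero, add_zero]
  have := dualMonomial_normalMonomial (n := 4) M M
  rw [normalMonomial_four, if_pos rfl] at this
  simp only [hM, Matrix.of_apply, Matrix.cons_val', Matrix.cons_val_zero,
    Matrix.cons_val_one, Matrix.cons_val_fin_one, Matrix.cons_val, pow_zero, mul_one,
    one_mul] at this
  simpa only [mul_assoc] using this


/-! ### The category -/

theorem comp_xi {lam mu nu : List ℕ} (A : Mat lam mu) (B : Mat mu nu) :
    comp (xi A) (xi B) = ∑ C : Mat lam nu, Z A B C • xi C := by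
  simp [comp, xi]

theorem star_xi {lam mu sig rho : List ℕ} (A : Mat lam mu) (B : Mat sig rho) :
    star (xi A) (xi B) = xi (A.diag B) := by
  unfold star
  rw [xi, xi, Finsupp.sum_single_index, Finsupp.sum_single_index, mul_one, one_smul]
  · rw [mul_zero, zero_smul]
  · rw [Finsupp.sum_single_index] <;> rw [zero_mul, zero_smul]

open Classical in
theorem comp_xi_eq_xi {lam mu nu : List ℕ} (A : Mat lam mu) (B : Mat mu nu) (C₀ : Mat lam nu)
    (h : ∀ C, Z A B C = if C = C₀ then 1 else 0) : comp (xi A) (xi B) = xi C₀ := by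
  rw [comp_xi, Finset.sum_eq_single C₀]
  · rw [h, if_pos rfl, one_smul]
  · intro C _ hC
    rw [h, if_neg hC, zero_smul]
  · exact fun h => absurd (Finset.mem_univ _) h

theorem Mat.pad_two {a b c d : ℕ} (A : Mat [a, b] [c, d]) : A.pad 2 = A.1 := by
  funext i j
  exact dif_pos ⟨i.2, j.2⟩

/-- The matrix of two merges. -/
def mergeMat (p s t : ℕ) : Mat [p + s, s + t] [p, s, s, t] :=
  ⟨!![p, s, 0, 0; 0, 0, s, t], by
    constructor
    · intro i; fin_cases i <;> simp [Fin.sum_univ_succ]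
    · intro j; fin_cases j <;> simp [Fin.sum_univ_succ]⟩

/-- The matrix of two splits. -/
def splitMat (p s t : ℕ) : Mat [p, s, s, t] [p + s, s + t] :=
  ⟨!![p, 0; s, 0; 0, s; 0, t], by
    constructor
    · intro i; fin_cases i <;> simp [Fin.sum_univ_succ]
    · intro j; fin_cases j <;> simp [Fin.sum_univ_succ]⟩

/-- The matrix of the crossing of two inner strings. -/
def innerCrossMat (p s t : ℕ) : Mat [p, s, s, t] [p, s, s, t] :=
  ⟨!![p, 0, 0, 0; 0, 0, s, 0; 0, s, 0, 0; 0, 0, 0, t], by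
    constructor
    · intro i; fin_cases i <;> simp [Fin.sum_univ_succ]
    · intro j; fin_cases j <;> simp [Fin.sum_univ_succ]⟩

/-- The matrix of the diagram formed by two splits and the crossing of the inner strings. -/
def crossSplitMat (p s t : ℕ) : Mat [p, s, s, t] [p + s, s + t] :=
  ⟨!![p, 0; 0, s; s, 0; 0, t], by
    constructor
    · intro i; fin_cases i <;> simp [Fin.sum_univ_succ]
    · intro j; fin_cases j <;> simp [Fin.sum_univ_succ]⟩

/-! ### The double coset diagram as a standard basis element. -/

theorem star_merge (p s t : ℕ) :
    (star (merge p s (p + s) rfl) (merge s t (s + t) rfl) : Hom [p, s, s, t] [p + s, s + t])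
      = xi (mergeMat p s t) :=
  (star_xi _ _).trans (congrArg xi (Subtype.ext (by
    funext i j; fin_cases i <;> fin_cases j <;> rfl)))

theorem star_split (p s t : ℕ) :
    (star (split p s (p + s) rfl) (split s t (s + t) rfl) : Hom [p + s, s + t] [p, s, s, t])
      = xi (splitMat p s t) :=
  (star_xi _ _).trans (congrArg xi (Subtype.ext (by
    funext i j; fin_cases i <;> fin_cases j <;> rfl)))

theorem star_crossing (p s t : ℕ) :
    (star (idHom [p]) (star (crossing s s) (idHom [t])) : Hom [p, s, s, t] [p, s, s, t])
      = xi (innerCrossMat p s t) :=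
  (congrArg (star _) (star_xi _ _)).trans ((star_xi _ _).trans (congrArg xi (Subtype.ext (by
    funext i j; fin_cases i <;> fin_cases j <;> rfl))))

theorem crossing_comp_split (p s t : ℕ) :
    comp (xi (innerCrossMat p s t)) (xi (splitMat p s t)) = xi (crossSplitMat p s t) := by
  classical
  refine comp_xi_eq_xi _ _ _ fun C => ?_
  obtain ⟨C, hr, hc⟩ := C
  have h0 := hr 0
  have h1 := hr 1
  have h2 := hr 2
  have h3 := hr 3
  have hc0 := hc 0
  change Matrix (Fin 4) (Fin 2) ℕ at C
  change ∑ j : Fin 2, C 0 j = p at h0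
  change ∑ j : Fin 2, C 1 j = s at h1
  change ∑ j : Fin 2, C 2 j = s at h2
  change ∑ j : Fin 2, C 3 j = t at h3
  change ∑ j : Fin 4, C j 0 = p + s at hc0
  rw [Fin.sum_univ_two] at h0 h1 h2 h3
  rw [Fin.sum_univ_four] at hc0
  have key := structConst_crossing_split p s t (fun i => C i 0) (fun i => C i 1) h0 h1 h2 h3 hc0
  refine Eq.trans ?_ (key.trans (if_congr ⟨fun h => ?_, fun h => ?_⟩ rfl rfl))
  · change structConst (n := 4) (Mat.pad _ 4) (Mat.pad _ 4) (Mat.pad _ 4) = _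
    congr 1 <;> funext i j <;> fin_cases i <;> fin_cases j <;> rfl
  · obtain ⟨a0, a1, a2, a3⟩ := h
    change C 0 0 = p at a0
    change C 1 0 = 0 at a1
    change C 2 0 = s at a2
    change C 3 0 = 0 at a3
    apply Subtype.ext
    change C = !![p, 0; 0, s; s, 0; 0, t]
    ext i j
    fin_cases i <;> fin_cases j <;> simp <;> omega
  · have h' : C = !![p, 0; 0, s; s, 0; 0, t] := congrArg Subtype.val h
    simp [h']

/-- The target matrix is given through its entries because `crossMat` has `p + s - s` where `p` is
wanted. -/
theorem merge_comp_crossSplit (p s t : ℕ) (C₀ : Mat [p + s, s + t] [p + s, s + t])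
    (hC₀ : C₀.1 = !![p, s; s, t]) :
    comp (xi (mergeMat p s t)) (xi (crossSplitMat p s t)) = xi C₀ := by
  classical
  refine comp_xi_eq_xi _ _ _ fun C => ?_
  obtain ⟨C, hr, hc⟩ := C
  have h0 := hr 0
  have h1 := hr 1
  have hc0 := hc 0
  change Matrix (Fin 2) (Fin 2) ℕ at C
  change ∑ j : Fin 2, C 0 j = p + s at h0
  change ∑ j : Fin 2, C 1 j = s + t at h1
  change ∑ j : Fin 2, C j 0 = p + s at hc0
  rw [Fin.sum_univ_two] at h0 h1 hc0
  -- The first row and the first column have the same sum `p + s`.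
  have h10 : C 1 0 = C 0 1 := by omega
  rw [h10] at h1
  refine Eq.trans ?_ ((structConst_merge p s t _ _ _ h0 h1).trans
    (if_congr ⟨fun h => ?_, fun h => ?_⟩ rfl rfl))
  · change structConst (n := 4) (Mat.pad _ 4) (Mat.pad _ 4) (Mat.pad _ 4) = _
    congr 1 <;> funext i j <;> fin_cases i <;> fin_cases j <;> first | rfl | exact h10
  · apply Subtype.ext
    rw [hC₀]
    change C = !![p, s; s, t]
    ext i j
    fin_cases i <;> fin_cases j <;> simp <;> omega
  · have h' : C = !![p, s; s, t] := (congrArg Subtype.val h).trans hC₀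
    simp [h']

theorem crossDiagram_eq_xi (a b s : ℕ) (h : s ≤ min a b) :
    crossDiagram a b s h = xi (crossMat a b s h) := by
  obtain ⟨p, rfl⟩ : ∃ p, a = p + s := ⟨a - s, by omega⟩
  obtain ⟨t, rfl⟩ : ∃ t, b = s + t := ⟨b - s, by omega⟩
  -- The objects of the diagram contain `p + s - s` and `s + t - s`; replacing these by variables
  -- with an equation avoids rewriting inside the types of morphisms.
  have e : ∀ (p' t' : ℕ) (hp : p' + s = p + s) (ht : s + t' = s + t),
      comp (lam := [p + s, s + t]) (mu := [p', s, s, t']) (nu := [p + s, s + t])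
        (star (merge p' s (p + s) hp) (merge s t' (s + t) ht))
        (comp (lam := [p', s, s, t']) (mu := [p', s, s, t']) (nu := [p + s, s + t])
          (star (idHom [p']) (star (crossing s s) (idHom [t'])))
          (star (split p' s (p + s) hp) (split s t' (s + t) ht)))
      = xi (crossMat (p + s) (s + t) s h) := by
    intro p' t' hp ht
    obtain rfl : p' = p := by omega
    obtain rfl : t' = t := by omega
    refine (congrArg₂ comp (star_merge p' s t') (congrArg₂ comp (star_crossing p' s t')
      (star_split p' s t'))).trans ?_
    rw [crossing_comp_split, merge_comp_crossSplit]
    change !![p' + s - s, s; s, s + t' - s] = _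
    rw [Nat.add_sub_cancel, Nat.add_sub_cancel_left]
  exact e _ _ _ _

/-! ### Expansion of the product of two crossings. -/

theorem bijective_crossMat (a b : ℕ) : Function.Bijective fun s : Fin (min a b + 1) =>
    crossMat a b s (Nat.le_of_lt_succ s.isLt) := by
  constructor
  · intro s s' h
    have h1 : (!![a - s, (s : ℕ); (s : ℕ), b - s] : Matrix (Fin 2) (Fin 2) ℕ)
        = !![a - s', (s' : ℕ); (s' : ℕ), b - s'] := congrArg Subtype.val h
    exact Fin.ext (congrFun (congrFun h1 0) 1)
  · rintro ⟨C, hr, hc⟩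
    have h0 := hr 0
    have h1 := hr 1
    have hc0 := hc 0
    change Matrix (Fin 2) (Fin 2) ℕ at C
    change ∑ j : Fin 2, C 0 j = a at h0
    change ∑ j : Fin 2, C 1 j = b at h1
    change ∑ j : Fin 2, C j 0 = a at hc0
    rw [Fin.sum_univ_two] at h0 h1 hc0
    -- The sums make both off-diagonal entries equal and bound them by `a` and by `b`.
    refine ⟨⟨C 0 1, by omega⟩, Subtype.ext ?_⟩
    change !![a - C 0 1, C 0 1; C 0 1, b - C 0 1] = C
    ext i j
    fin_cases i <;> fin_cases j <;> simp <;> omega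

theorem Z_crossing (a b s : ℕ) (h : s ≤ min a b) (A : Mat [a, b] [b, a]) (B : Mat [b, a] [a, b])
    (hA : A.1 = !![0, a; b, 0]) (hB : B.1 = !![0, b; a, 0]) :
    Z A B (crossMat a b s h)
      = qpow (-((s : ℤ) * ((s : ℤ) - 1) / 2) - (s : ℤ) * ((a : ℤ) + (b : ℤ) - 2 * (s : ℤ)))
        * (qpow (-1) - qpow 1) ^ s * qFactorial s := by
  change structConst (n := 2) (A.pad 2) (B.pad 2) (Mat.pad _ 2) = _
  rw [Mat.pad_two, Mat.pad_two, Mat.pad_two, hA, hB]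
  obtain ⟨c, rfl⟩ : ∃ c, a = c + s := ⟨a - s, by omega⟩
  obtain ⟨d, rfl⟩ : ∃ d, b = s + d := ⟨b - s, by omega⟩
  change structConst _ _ !![c + s - s, s; s, s + d - s] = _
  rw [Nat.add_sub_cancel, Nat.add_sub_cancel_left]
  refine (structConst_crossing s c d).trans ?_
  push_cast
  rw [show (c + s + (s + d) - 2 * s : ℤ) = c + d by ring]

theorem crossing_comp_crossing (a b : ℕ) :
    comp (crossing b a) (crossing a b)
      = ∑ s : Fin (min a b + 1),
          (qpow (-((s : ℤ) * ((s : ℤ) - 1) / 2) - (s : ℤ) * ((a : ℤ) + (b : ℤ) - 2 * (s : ℤ)))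
              * (qpow (-1) - qpow 1) ^ (s : ℕ) * qFactorial s)
            • xi (crossMat a b s (Nat.le_of_lt_succ s.isLt)) := by
  refine (comp_xi _ _).trans ?_
  refine (Function.Bijective.sum_comp (bijective_crossMat a b) _).symm.trans
    (Finset.sum_congr rfl fun s _ => ?_)
  exact congrArg (· • _) (Z_crossing _ _ _ _ _ _ rfl rfl)

end QSchur

end

theorem corollary1984 (a b : ℕ) :
    QSchur.comp (QSchur.crossing b a) (QSchur.crossing a b)
      = ∑ s : Fin (min a b + 1),
          (QSchur.qpow (-((s : ℤ) * ((s : ℤ) - 1) / 2) - (s : ℤ) * ((a : ℤ) + (b : ℤ) - 2 * (s : ℤ)))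
              * (QSchur.qpow (-1) - QSchur.qpow 1) ^ (s : ℕ) * QSchur.qFactorial s)
            • QSchur.crossDiagram a b s (Nat.le_of_lt_succ s.isLt)
    ∧ ∀ (s : ℕ) (hs : s ≤ min a b),
        QSchur.crossDiagram a b s hs = QSchur.xi (QSchur.crossMat a b s hs) := by
  refine ⟨?_, QSchur.crossDiagram_eq_xi a b⟩
  simp only [QSchur.crossDiagram_eq_xi]
  exact QSchur.crossing_comp_crossing a b
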